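/- Let $(X,d)$ be a complete separable metric space and let $E:X\to\mathbb R\cup\{+\infty\}$ be lower semicontinuous, with dense domain $D(E)=\{E<\infty\}$, and bounded from below on every bounded subset of $X$. Let $\lambda\in\mathbb R$ and suppose that every $x\in X$ is the starting point of an $\mathrm{EVI}_\lambda$-gradient flow of $E$, i.e. of a curve $(\eta_t)_{t>0}$ in $AC_{loc}((0,\infty),X)$ with $\eta_t\to x$ as $t\downarrow0$ such that, for every $y\in X$, $$\tfrac12\tfrac{\mathrm d}{\mathrm dt}d^2(\eta_t,y)+\tfrac\lambda2 d^2(\eta_t,y)+E(\eta_t)\le E(y)\qquad\text{for a.e. }t>0 .$$ Such a flow is unique; write $S_tx:=\eta_t$ for $t>0$ and $S_0x:=x$. For an absolutely continuous curve $\gamma$ let $|\dot\gamma_t|=\lim_{s\to t}d(\gamma_s,\gamma_t)/|s-t|$ (which exists for a.e. $t$) be its metric speed, and say $\gamma\in AC^2([0,1],X)$ if $\gamma$ is absolutely continuous on $[0,1]$ and $|\dot\gamma|\in L^2(0,1)$. Let $|\partial E|(x)=\limsup_{y\to x}[E(x)-E(y)]^+/d(x,y)$ for $x\in D(E)$ (with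 value $0$ if $x$ is isolated) and $|\partial E|(x)=+\infty$ for $x\notin D(E)$ be the slope of $E$, and put $\lambda^-=\max\{-\lambda,0\}$. Let $\varepsilon>0$, let $\gamma\in AC^2([0,1],X)$ satisfy $E(\gamma_0),E(\gamma_1)<\infty$, and define $$\gamma^\varepsilon_t:=S_{\varepsilon\min\{t,1-t\}}\gamma_t,\qquad t\in[0,1].$$ Then $\gamma^\varepsilon\in AC^2([0,1],X)$, the function $t\mapsto E(\gamma^\varepsilon_t)$ is finite and absolutely continuous on $[0,1]$, $t\mapsto|\partial E|(\gamma^\varepsilon_t)$ belongs to $L^2(0,1)$, and $$\frac12\int_0^1|\dot\gamma^\varepsilon_t|^2\,\mathrm dt+\frac{\varepsilon^2}2\int_0^1|\partial E|^2(\gamma^\varepsilon_t)\,\mathrm dt\le\frac12e^{\lambda^-\varepsilon}\int_0^1|\dot\gamma_t|^2\,\mathrm dt-2\varepsilon E(\gamma^\varepsilon_{1/2})+\varepsilon\big(E(\gamma_0)+E(\gamma_1)\big).$$ -/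

import Mathlib

open MeasureTheory Filter Topology
open scoped ENNReal

noncomputable section

/-- The proper domain `D(E) = {E < +∞}` of a functional with values in `(-∞, +∞]`. -/
def energyDomain {X : Type*} (E : X → EReal) : Set X := {x | E x < ⊤}

/-- The metric speed `|γ̇_t| = lim_{s → t} d(γ_s, γ_t) / |s - t|`, written as an upper limit so that
it is defined at every `t`; for absolutely continuous curves the limit exists at almost every
time. -/
def metricSpeed {X : Type*} [MetricSpace X] (γ : ℝ → X) (t : ℝ) : ℝ≥0∞ :=
  limsup (fun s : ℝ => edist (γ s) (γ t) / edist s t) (𝓝[≠] t)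

/-- `γ ∈ AC²([0,1], X)`: absolutely continuous on `[0,1]` with metric speed in `L²(0,1)`.
Only the values of `γ` on `[0,1]` matter. -/
def IsAC2 {X : Type*} [MetricSpace X] (γ : ℝ → X) : Prop :=
  AbsolutelyContinuousOnInterval γ 0 1 ∧
    MemLp (metricSpeed γ) 2 (volume.restrict (Set.Ioo (0 : ℝ) 1))

/-- The descending slope `|∂E|(x) = limsup_{y → x} [E(x) - E(y)]⁺ / d(x,y)` for `x ∈ D(E)`, and `+∞`
outside `D(E)`. At an isolated point of `X` the filter `𝓝[≠] x` is trivial and the upper limit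
is `0`. -/
def metricSlope {X : Type*} [MetricSpace X] (E : X → EReal) (x : X) : ℝ≥0∞ :=
  open Classical in
  if x ∈ energyDomain E then
    limsup (fun y : X => (E x - E y).toENNReal / edist x y) (𝓝[≠] x)
  else ⊤

/-- `(η_t)_{t>0}` is a gradient flow of `E` in the `EVI_lam` sense: `η ∈ AC_loc((0,∞), X)` and
`½ d/dt d²(η_t, y) + (lam/2) d²(η_t, y) + E(η_t) ≤ E(y)` for all `y` and almost every `t > 0`. Only
the values of `η` on `(0,∞)` matter. -/
structure IsEVIFlow {X : Type*} [MetricSpace X] (E : X → EReal) (lam : ℝ) (η : ℝ → X) : Prop where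
  locally_ac : ∀ a b : ℝ, 0 < a → a ≤ b → AbsolutelyContinuousOnInterval η a b
  evi : ∀ y : X, ∀ᵐ t ∂(volume.restrict (Set.Ioi (0 : ℝ))),
    (((1 / 2) * deriv (fun s : ℝ => dist (η s) y ^ 2) t + (lam / 2) * dist (η t) y ^ 2 : ℝ) : EReal)
      + E (η t) ≤ E y

/-- `η` is an `EVI_lam` gradient flow of `E` starting at `x ∈ closure D(E)`. -/
structure IsEVIFlowFrom {X : Type*} [MetricSpace X] (E : X → EReal) (lam : ℝ) (x : X)
    (η : ℝ → X) : Prop where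
  isEVIFlow : IsEVIFlow E lam η
  mem_closure : x ∈ closure (energyDomain E)
  tendsto : Tendsto η (𝓝[>] 0) (𝓝 x)

/-- The semigroup `S_t x` of the `EVI_lam` flow of `E`: `S_0 x = x` and, for `t > 0`, `S_t x = η_t`
where `η` is the `EVI_lam` gradient flow starting at `x` (which is unique on `(0,∞)` when it
exists). For `t ≤ 0`, or if there is no such flow, the value is `x`. -/
def eviSemigroup {X : Type*} [MetricSpace X] (E : X → EReal) (lam : ℝ) (t : ℝ) (x : X) : X :=
  open Classical in
  if h : 0 < t ∧ ∃ η : ℝ → X, IsEVIFlowFrom E lam x η then h.2.choose t else x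

/-- The standing assumptions on `E : X → (-∞, +∞]` and `lam ∈ ℝ`: `E` is lower semicontinuous, has
dense domain, is bounded from below on bounded sets, and every point of `X` is the starting point
of an `EVI_lam` gradient flow of `E`. -/
structure EVISetting {X : Type*} [MetricSpace X] (E : X → EReal) (lam : ℝ) : Prop where
  ne_bot : ∀ x, E x ≠ ⊥
  lsc : LowerSemicontinuous E
  dense_domain : Dense (energyDomain E)
  bddBelow_of_isBounded : ∀ B : Set X, Bornology.IsBounded B →
    ∃ c : ℝ, ∀ x ∈ B, (c : EReal) ≤ E x
  exists_flow : ∀ x : X, ∃ η : ℝ → X, IsEVIFlowFrom E lam x η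

/-- The regularized curve `γ^ε_t = S_{ε min(t, 1 - t)} γ_t`. -/
def regularizedCurve {X : Type*} [MetricSpace X] (E : X → EReal) (lam ε : ℝ) (γ : ℝ → X) :
    ℝ → X :=
  fun t => eviSemigroup E lam (ε * min t (1 - t)) (γ t)

end

/-!
Integrating the evolution variational inequality against `e^{λ t}` bounds
`e^{λ h} d²(η_{t+h}, y) - d²(η_t, y)` by `2 (E(y) - E(η_{t+h})) ∫₀ʰ e^{λ r} dr`. All properties of
the flow follow: `S_t` is Lipschitz with constant `e^{-λ t}`, and along the flow the global slope
`sup_y [E(x) - E(y) + (λ/2) d²(x, y)]⁺ / d(x, y)`, which dominates `|∂E|(x)`, is finite at positive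
times.

Let now `β_t = S_{τ(t)} γ_t` with `τ(t) = ε min(t, 1 - t)`. To compare `β_s` with `β_t`, run both
flows for the shorter of the two times and then only one of them for the remaining `|τ(s) - τ(t)|`.
Contraction in the first stage, and the integrated inequality with the dissipation of energy in the
second, give up to errors which vanish as `s → t`
`d²(β_s, β_t) + 2 (E(β_s) - E(β_t)) (τ(s) - τ(t)) + |∂E|²(β_t) (τ(s) - τ(t))²
  ≤ e^{2 λ⁻ τ(t)} d²(γ_s, γ_t)`.
Divided by `(s - t)²` this becomes, because `2 τ ≤ ε`,
`|β̇_t|² + ε² |∂E|²(β_t) ≤ e^{λ⁻ ε} |γ̇_t|² - 2 τ'(t) (E ∘ β)'(t)`, and since `τ' = ε` on `(0, 1/2)`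
and `τ' = -ε` on `(1/2, 1)`, the integral of the last term is a combination of the values of the
energy at `0`, `1/2` and `1`.
-/

open Set

section AbsolutelyContinuous

variable {X Y Z : Type*} [PseudoMetricSpace X] [PseudoMetricSpace Y] [PseudoMetricSpace Z]
  {f : ℝ → X} {a b : ℝ}

lemma absolutelyContinuousOnInterval_of_dist_le {g : ℝ → Y} {h : ℝ → Z}
    (hg : AbsolutelyContinuousOnInterval g a b) (hh : AbsolutelyContinuousOnInterval h a b)
    (A B : ℝ) (hf : ∀ s ∈ uIcc a b, ∀ t ∈ uIcc a b,
      dist (f s) (f t) ≤ A * dist (g s) (g t) + B * dist (h s) (h t)) :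
    AbsolutelyContinuousOnInterval f a b := by
  have hlim := (Tendsto.const_mul A hg).add (Tendsto.const_mul B hh)
  rw [mul_zero, mul_zero, add_zero] at hlim
  refine squeeze_zero' (.of_forall fun J => Finset.sum_nonneg fun i _ => dist_nonneg) ?_ hlim
  filter_upwards [mem_inf_of_right (mem_principal_self _)] with J hJ
  rw [Finset.mul_sum, Finset.mul_sum, ← Finset.sum_add_distrib]
  exact Finset.sum_le_sum fun i hi => hf _ (hJ.1 i hi).1 _ (hJ.1 i hi).2

lemma absolutelyContinuousOnInterval_dist_const (hf : AbsolutelyContinuousOnInterval f a b)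
    (x : X) : AbsolutelyContinuousOnInterval (fun t => dist (f t) x) a b :=
  absolutelyContinuousOnInterval_of_dist_le hf hf 1 0 fun s _ t _ => by
    simpa only [Real.dist_eq, one_mul, zero_mul, add_zero] using abs_dist_sub_le (f s) (f t) x

lemma continuousOn_of_absolutelyContinuousOnInterval (hab : a ≤ b)
    (hf : AbsolutelyContinuousOnInterval f a b) : ContinuousOn f (Icc a b) := by
  intro t ht
  rw [← uIcc_of_le hab] at ht ⊢
  have hdist := (absolutelyContinuousOnInterval_dist_const hf (f t)).continuousOn t ht
  rw [ContinuousWithinAt, dist_self] at hdist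
  exact tendsto_iff_dist_tendsto_zero.2 hdist

lemma tendsto_comp_add_mul_of_continuousOn {W : Type*} [TopologicalSpace W] {g : ℝ → W}
    (hg : ContinuousOn g (Icc a b)) {s t : ℝ} (hs : s ∈ Icc a b) (ht : t ∈ Icc a b) :
    Tendsto (fun r => g (s + r * (t - s))) (𝓝[>] 0) (𝓝 (g s)) := by
  refine (hg s hs).tendsto.comp (tendsto_nhdsWithin_iff.2 ⟨?_, ?_⟩)
  · have hcont : Tendsto (fun r : ℝ => s + r * (t - s)) (𝓝 0) (𝓝 (s + 0 * (t - s))) :=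
      Continuous.tendsto (by fun_prop) 0
    rw [zero_mul, add_zero] at hcont
    exact hcont.mono_left nhdsWithin_le_nhds
  · filter_upwards [Ioo_mem_nhdsGT one_pos] with r hr
    have hmem := (convex_Icc a b) hs ht (sub_nonneg.2 hr.2.le) hr.1.le (sub_add_cancel 1 r)
    simp only [smul_eq_mul] at hmem
    convert hmem using 1
    ring

lemma dist_le_intervalIntegral_of_Ioo {m : ℝ → ℝ} (hf : ContinuousOn f (Icc a b))
    (hm : IntervalIntegrable m volume a b)
    (h : ∀ s t, a < s → s ≤ t → t < b → dist (f s) (f t) ≤ ∫ r in s..t, m r)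
    {s t : ℝ} (hs : a ≤ s) (hst : s ≤ t) (ht : t ≤ b) :
    dist (f s) (f t) ≤ ∫ r in s..t, m r := by
  rcases hst.eq_or_lt with rfl | hst
  · simp only [dist_self, intervalIntegral.integral_same, le_refl]
  have hsmem : s ∈ Icc a b := ⟨hs, hst.le.trans ht⟩
  have htmem : t ∈ Icc a b := ⟨hs.trans hst.le, ht⟩
  have hsub : ∀ r ∈ Icc a b, IntervalIntegrable m volume a r := fun r hr =>
    hm.mono_set (by rw [uIcc_of_le hr.1, uIcc_of_le (hr.1.trans hr.2)]
                    exact Icc_subset_Icc_right hr.2)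
  have hprim : ContinuousOn (fun r => ∫ v in a..r, m v) (Icc a b) := by
    rw [← uIcc_of_le (hsmem.1.trans hsmem.2)]
    exact intervalIntegral.continuousOn_primitive_interval' hm left_mem_uIcc
  rw [← intervalIntegral.integral_interval_sub_left (hsub t htmem) (hsub s hsmem)]
  refine le_of_tendsto_of_tendsto
    ((tendsto_comp_add_mul_of_continuousOn hf hsmem htmem).dist
      (tendsto_comp_add_mul_of_continuousOn hf htmem hsmem))
    ((tendsto_comp_add_mul_of_continuousOn hprim htmem hsmem).sub
      (tendsto_comp_add_mul_of_continuousOn hprim hsmem htmem)) ?_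
  filter_upwards [Ioo_mem_nhdsGT (show (0 : ℝ) < 1 / 2 by norm_num)] with r hr
  have hr0 : 0 < r * (t - s) := mul_pos hr.1 (sub_pos.2 hst)
  have hr1 : r * (t - s) < 1 / 2 * (t - s) := mul_lt_mul_of_pos_right hr.2 (sub_pos.2 hst)
  rw [intervalIntegral.integral_interval_sub_left (hsub _ ⟨by linarith, by linarith⟩)
    (hsub _ ⟨by linarith, by linarith⟩)]
  exact h _ _ (by linarith) (by linarith) (by linarith)

lemma absolutelyContinuousOnInterval_of_dist_le_integral {m : ℝ → ℝ} (hab : a ≤ b)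
    (hf : ContinuousOn f (Icc a b)) (hm : IntervalIntegrable m volume a b)
    (h : ∀ s t, a < s → s ≤ t → t < b → dist (f s) (f t) ≤ ∫ r in s..t, m r) :
    AbsolutelyContinuousOnInterval f a b := by
  have hprim := hm.absolutelyContinuousOnInterval_intervalIntegral (c := a) left_mem_uIcc
  have hsub : ∀ r ∈ Icc a b, IntervalIntegrable m volume a r := fun r hr =>
    hm.mono_set (by rw [uIcc_of_le hr.1, uIcc_of_le hab]; exact Icc_subset_Icc_right hr.2)
  have hle : ∀ s ∈ Icc a b, ∀ t ∈ Icc a b, s ≤ t →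
      dist (f s) (f t) ≤ dist (∫ v in a..s, m v) (∫ v in a..t, m v) := by
    intro s hs t ht hst
    rw [dist_comm (∫ v in a..s, m v), Real.dist_eq,
      intervalIntegral.integral_interval_sub_left (hsub t ht) (hsub s hs)]
    exact (dist_le_intervalIntegral_of_Ioo hf hm h hs.1 hst ht.2).trans (le_abs_self _)
  refine absolutelyContinuousOnInterval_of_dist_le hprim hprim 1 0 fun s hs t ht => ?_
  rw [uIcc_of_le hab] at hs ht
  rw [one_mul, zero_mul, add_zero]
  rcases le_total s t with hst | hts
  · exact hle s hs t ht hst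
  · rw [dist_comm, dist_comm (∫ v in a..s, m v)]
    exact hle t ht s hs hts

end AbsolutelyContinuous

section Measurability

variable {Y : Type*}

lemma lowerSemicontinuousAt_ennreal_div [TopologicalSpace Y] {f g : Y → ℝ≥0∞} {x : Y}
    (hf : LowerSemicontinuousAt f x) (hg : ContinuousAt g x) (hg_top : ∀ z, g z ≠ ⊤) :
    LowerSemicontinuousAt (fun z => f z / g z) x := by
  intro c hc
  obtain ⟨c', hcc', hc'⟩ := exists_between (ENNReal.mul_lt_of_lt_div hc)
  have hcg : ContinuousAt (fun z => c * g z) x :=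
    (ENNReal.continuous_const_mul hc.ne_top).continuousAt.comp hg
  filter_upwards [hf c' hc', hcg.eventually (gt_mem_nhds hcc')] with z hfz hgz
  exact (ENNReal.lt_div_iff_mul_lt (.inr hc.ne_top) (.inl (hg_top z))).2 (hgz.trans hfz)

lemma measurable_limsup_div_edist [MetricSpace Y] [MeasurableSpace Y] [BorelSpace Y]
    {A : Y → Y → ℝ≥0∞} (hA : ∀ y, LowerSemicontinuous fun x => A x y) :
    Measurable fun x => limsup (fun y => A x y / edist x y) (𝓝[≠] x) := by
  have hbasis : ∀ x, limsup (fun y => A x y / edist x y) (𝓝[≠] x) =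
      ⨅ n : ℕ, ⨆ y ∈ Metric.ball x (1 / ((n : ℝ) + 1)) ∩ {x}ᶜ, A x y / edist x y := by
    intro x
    rw [(nhdsWithin_hasBasis (Metric.nhds_basis_ball_inv_nat_succ (x := x)) _).limsup_eq_iInf_iSup]
    simp only [iInf_true]
  simp_rw [hbasis]
  refine .iInf fun n => LowerSemicontinuous.measurable fun x c hc => ?_
  obtain ⟨y, ⟨hy_ball, hy_ne⟩, hy⟩ := lt_biSup_iff.1 hc
  have hquot : LowerSemicontinuousAt (fun z => A z y / edist z y) x :=
    lowerSemicontinuousAt_ennreal_div (hA y x) (by fun_prop) fun z => edist_ne_top z y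
  filter_upwards [hquot c hy, Metric.isOpen_ball.mem_nhds (Metric.mem_ball_comm.1 hy_ball),
    isOpen_ne.mem_nhds (Ne.symm hy_ne)] with z hz hz_ball hz_ne
  exact hz.trans_le <| le_iSup₂ (f := fun y (_ : y ∈ Metric.ball z (1 / ((n : ℝ) + 1)) ∩ {z}ᶜ) =>
    A z y / edist z y) y ⟨Metric.mem_ball_comm.1 hz_ball, Ne.symm hz_ne⟩

end Measurability

section MetricSpeed

variable {X : Type*} [MetricSpace X] {γ : ℝ → X} {s t a b : ℝ}

lemma metricSpeed_congr {γ' : ℝ → X} (h : γ =ᶠ[𝓝 t] γ') : metricSpeed γ t = metricSpeed γ' t := by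
  refine limsup_congr ?_
  filter_upwards [h.filter_mono nhdsWithin_le_nhds] with s hs
  rw [hs, h.eq_of_nhds]

lemma measurable_metricSpeed (hγ : Continuous γ) : Measurable (metricSpeed γ) := by
  have hmeas := measurable_limsup_div_edist (A := fun t s : ℝ => edist (γ s) (γ t)) fun s =>
    (continuous_const.edist hγ).lowerSemicontinuous
  unfold metricSpeed
  simpa only [edist_comm] using hmeas

lemma aemeasurable_metricSpeed (hab : a ≤ b) (hγ : ContinuousOn γ (Icc a b)) :
    AEMeasurable (metricSpeed γ) (volume.restrict (Ioo a b)) := by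
  refine ⟨_, measurable_metricSpeed (γ := IccExtend hab ((Icc a b).domRestrict γ))
    hγ.domRestrict.Icc_extend', ?_⟩
  filter_upwards [ae_restrict_mem measurableSet_Ioo] with t ht
  refine metricSpeed_congr ?_
  filter_upwards [isOpen_Ioo.mem_nhds ht] with s hs
  rw [IccExtend_of_mem hab _ (Ioo_subset_Icc_self hs), domRestrict_apply]

lemma enorm_deriv_le_metricSpeed {f : ℝ → ℝ} (hf : DifferentiableAt ℝ f t)
    (h : ∀ s, edist (f s) (f t) ≤ edist (γ s) (γ t)) : ‖deriv f t‖ₑ ≤ metricSpeed γ t := by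
  have hslope : Tendsto (fun s => ‖slope f t s‖ₑ) (𝓝[≠] t) (𝓝 ‖deriv f t‖ₑ) :=
    (hasDerivAt_iff_tendsto_slope.1 hf.hasDerivAt).enorm
  rw [← hslope.limsup_eq]
  refine limsup_le_limsup ?_
  filter_upwards [self_mem_nhdsWithin] with s hst
  have hne : s - t ≠ 0 := sub_ne_zero.2 hst
  rw [slope_def_field, edist_eq_enorm_sub s t, div_eq_mul_inv, enorm_mul, enorm_inv hne,
    ← div_eq_mul_inv, ← edist_eq_enorm_sub]
  gcongr
  exact h s

lemma edist_le_lintegral_metricSpeed (hst : s ≤ t) (hγ : AbsolutelyContinuousOnInterval γ s t) :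
    edist (γ s) (γ t) ≤ ∫⁻ r in Ioo s t, metricSpeed γ r := by
  have hdist := absolutelyContinuousOnInterval_dist_const hγ (γ s)
  have hftc := hdist.integral_deriv_eq_sub
  rw [dist_self, sub_zero] at hftc
  calc edist (γ s) (γ t) = ‖∫ r in s..t, deriv (fun r => dist (γ r) (γ s)) r‖ₑ := by
        rw [hftc, edist_comm, edist_dist, Real.enorm_of_nonneg dist_nonneg]
    _ ≤ ∫⁻ r in Ioo s t, ‖deriv (fun r => dist (γ r) (γ s)) r‖ₑ := by
        rw [intervalIntegral.integral_of_le hst, setLIntegral_congr Ioo_ae_eq_Ioc]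
        exact enorm_integral_le_lintegral_enorm _
    _ ≤ ∫⁻ r in Ioo s t, metricSpeed γ r := by
        refine lintegral_mono_ae ((ae_restrict_iff' measurableSet_Ioo).2 ?_)
        filter_upwards [hdist.ae_differentiableAt] with r hdiff hr
        rw [uIcc_of_le hst] at hdiff
        refine enorm_deriv_le_metricSpeed (hdiff (Ioo_subset_Icc_self hr)) fun v => ?_
        rw [edist_dist, edist_dist]
        exact ENNReal.ofReal_le_ofReal (abs_dist_sub_le _ _ _)

lemma edist_sq_le_lintegral_metricSpeed_sq (hst : s ≤ t)
    (hγ : AbsolutelyContinuousOnInterval γ s t) :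
    edist (γ s) (γ t) ^ 2 ≤ ENNReal.ofReal (t - s) * ∫⁻ r in Ioo s t, metricSpeed γ r ^ 2 := by
  have hmeas := aemeasurable_metricSpeed hst (continuousOn_of_absolutelyContinuousOnInterval hst hγ)
  have hholder := ENNReal.lintegral_mul_le_Lp_mul_Lq (volume.restrict (Ioo s t))
    (g := fun _ => 1) Real.HolderConjugate.two_two hmeas aemeasurable_const
  simp only [Pi.mul_apply, mul_one, one_pow, lintegral_const, Measure.restrict_apply_univ,
    Real.volume_Ioo, one_mul, ENNReal.rpow_two] at hholder
  calc edist (γ s) (γ t) ^ 2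
      ≤ ((∫⁻ r in Ioo s t, metricSpeed γ r ^ 2) ^ (1 / 2 : ℝ)
        * ENNReal.ofReal (t - s) ^ (1 / 2 : ℝ)) ^ 2 := by
        gcongr
        exact (edist_le_lintegral_metricSpeed hst hγ).trans hholder
    _ = ENNReal.ofReal (t - s) * ∫⁻ r in Ioo s t, metricSpeed γ r ^ 2 := by
        rw [mul_pow, ← ENNReal.rpow_mul_natCast, ← ENNReal.rpow_mul_natCast, mul_comm]
        norm_num

lemma integral_toReal_eq_toReal_lintegral_Ioo {f : ℝ → ℝ≥0∞} (hab : a ≤ b)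
    (hf : AEMeasurable f (volume.restrict (Ioo a b))) (hfin : ∫⁻ r in Ioo a b, f r ≠ ⊤) :
    ∫ r in a..b, (f r).toReal = (∫⁻ r in Ioo a b, f r).toReal := by
  rw [intervalIntegral.integral_of_le hab, ← setIntegral_congr_set Ioo_ae_eq_Ioc,
    integral_toReal hf (ae_lt_top' hf hfin)]

lemma dist_le_integral_metricSpeed (hst : s ≤ t) (hγ : AbsolutelyContinuousOnInterval γ s t)
    (hfin : ∫⁻ r in Ioo s t, metricSpeed γ r ≠ ⊤) :
    dist (γ s) (γ t) ≤ ∫ r in s..t, (metricSpeed γ r).toReal := by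
  rw [integral_toReal_eq_toReal_lintegral_Ioo hst (aemeasurable_metricSpeed hst
    (continuousOn_of_absolutelyContinuousOnInterval hst hγ)) hfin, dist_edist]
  exact ENNReal.toReal_mono hfin (edist_le_lintegral_metricSpeed hst hγ)

lemma dist_sq_le_integral_metricSpeed_sq (hst : s ≤ t)
    (hγ : AbsolutelyContinuousOnInterval γ s t)
    (hfin : ∫⁻ r in Ioo s t, metricSpeed γ r ^ 2 ≠ ⊤) :
    dist (γ s) (γ t) ^ 2 ≤ (t - s) * ∫ r in s..t, (metricSpeed γ r ^ 2).toReal := by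
  rw [integral_toReal_eq_toReal_lintegral_Ioo hst ((aemeasurable_metricSpeed hst
    (continuousOn_of_absolutelyContinuousOnInterval hst hγ)).pow_const 2) hfin, dist_edist,
    ← ENNReal.toReal_pow]
  refine (ENNReal.toReal_mono (ENNReal.mul_ne_top ENNReal.ofReal_ne_top hfin)
    (edist_sq_le_lintegral_metricSpeed_sq hst hγ)).trans_eq ?_
  rw [ENNReal.toReal_mul, ENNReal.toReal_ofReal (sub_nonneg.2 hst)]

lemma eventually_dist_le_of_metricSpeed_lt {m : ℝ} (h : metricSpeed γ t < ENNReal.ofReal m) :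
    ∀ᶠ s in 𝓝[≠] t, dist (γ s) (γ t) ≤ m * |s - t| := by
  filter_upwards [eventually_lt_of_limsup_lt h, self_mem_nhdsWithin] with s hs hst
  have hst_pos : 0 < dist s t := dist_pos.2 hst
  rw [edist_dist, edist_dist, ← ENNReal.ofReal_div_of_pos hst_pos] at hs
  have hdiv := ((ENNReal.ofReal_lt_ofReal_iff'.1 hs).1).le
  rwa [div_le_iff₀ hst_pos, Real.dist_eq] at hdiv

lemma metricSpeed_sq_le_of_tendsto {φ : ℝ → ℝ} {r : ℝ} (hφ : Tendsto φ (𝓝[≠] t) (𝓝 r))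
    (h : ∀ᶠ s in 𝓝[≠] t, dist (γ s) (γ t) ^ 2 ≤ φ s * (s - t) ^ 2) :
    0 ≤ r ∧ metricSpeed γ t ^ 2 ≤ ENNReal.ofReal r := by
  have hφ_nonneg : ∀ᶠ s in 𝓝[≠] t, 0 ≤ φ s := by
    filter_upwards [h, self_mem_nhdsWithin] with s hs hst
    have : 0 < (s - t) ^ 2 := sq_pos_of_ne_zero (sub_ne_zero.2 hst)
    exact nonneg_of_mul_nonneg_left ((sq_nonneg _).trans hs) this
  have hr : 0 ≤ r := ge_of_tendsto hφ hφ_nonneg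
  have hsqrt : Tendsto (fun s => ENNReal.ofReal (√(φ s))) (𝓝[≠] t) (𝓝 (ENNReal.ofReal √r)) :=
    ENNReal.tendsto_ofReal hφ.sqrt
  have hspeed : metricSpeed γ t ≤ ENNReal.ofReal √r := by
    rw [← hsqrt.limsup_eq]
    refine limsup_le_limsup ?_
    filter_upwards [h, self_mem_nhdsWithin] with s hs hst
    have hst_pos : 0 < dist s t := dist_pos.2 hst
    rw [edist_dist, edist_dist, ← ENNReal.ofReal_div_of_pos hst_pos]
    refine ENNReal.ofReal_le_ofReal (Real.le_sqrt_of_sq_le ?_)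
    rwa [div_pow, div_le_iff₀ (by positivity), Real.dist_eq s, sq_abs]
  refine ⟨hr, (pow_le_pow_left' hspeed 2).trans_eq ?_⟩
  rw [← ENNReal.ofReal_pow (Real.sqrt_nonneg r), Real.sq_sqrt hr]

end MetricSpeed

section ExpMean

/-- The mean `∫₀¹ e^{x r} dr` of the exponential between `0` and `x`, that is `(eˣ - 1) / x`
continued by `1` to `x = 0`. It normalizes the integrals `∫ₛᵗ e^{λ (r - s)} dr` of the integrated
evolution variational inequality. -/
noncomputable def expMean (x : ℝ) : ℝ := ∫ r in (0 : ℝ)..1, Real.exp (x * r)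

@[simp] lemma expMean_zero : expMean 0 = 1 := by simp [expMean]

@[fun_prop] lemma continuous_expMean : Continuous expMean :=
  intervalIntegral.continuous_parametric_intervalIntegral_of_continuous' (by fun_prop) 0 1

lemma integral_exp_mul_sub (lam s t : ℝ) :
    ∫ r in s..t, Real.exp (lam * (r - s)) = (t - s) * expMean (lam * (t - s)) := by
  have hscale := intervalIntegral.smul_integral_comp_mul_add (a := 0) (b := 1)
    (fun r => Real.exp (lam * (r - s))) (t - s) s
  rw [mul_zero, zero_add, mul_one, sub_add_cancel, smul_eq_mul] at hscale
  rw [← hscale, expMean]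
  simp only [add_sub_cancel_right, mul_assoc]

lemma mul_expMean (x : ℝ) : x * expMean x = Real.exp x - 1 := by
  have h := integral_exp_mul_sub 1 0 x
  simp only [one_mul, sub_zero] at h
  rw [← h, integral_exp, Real.exp_zero]

lemma exp_neg_abs_le_expMean (x : ℝ) : Real.exp (-|x|) ≤ expMean x := by
  have hconst : ∫ _ in (0 : ℝ)..1, Real.exp (-|x|) = Real.exp (-|x|) := by simp
  rw [← hconst]
  refine intervalIntegral.integral_mono_on zero_le_one intervalIntegrable_const
    (Continuous.intervalIntegrable (by fun_prop) _ _) fun r hr => Real.exp_le_exp.2 ?_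
  calc -|x| ≤ -(|x| * r) := neg_le_neg (mul_le_of_le_one_right (abs_nonneg x) hr.2)
    _ = -|x * r| := by rw [abs_mul, abs_of_nonneg hr.1]
    _ ≤ x * r := neg_abs_le _

lemma expMean_le_exp_abs (x : ℝ) : expMean x ≤ Real.exp |x| := by
  have hconst : ∫ _ in (0 : ℝ)..1, Real.exp |x| = Real.exp |x| := by simp
  rw [← hconst]
  refine intervalIntegral.integral_mono_on zero_le_one
    (Continuous.intervalIntegrable (by fun_prop) _ _) intervalIntegrable_const
    fun r hr => Real.exp_le_exp.2 ?_
  calc x * r ≤ |x * r| := le_abs_self _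
    _ = |x| * r := by rw [abs_mul, abs_of_nonneg hr.1]
    _ ≤ |x| := mul_le_of_le_one_right (abs_nonneg x) hr.2

lemma expMean_pos (x : ℝ) : 0 < expMean x := (Real.exp_pos _).trans_le (exp_neg_abs_le_expMean x)

end ExpMean

section Energy

variable {X : Type*} [TopologicalSpace X] {E : X → EReal}

lemma exists_real_le_of_isCompact (hbot : ∀ x, E x ≠ ⊥) (hlsc : LowerSemicontinuous E)
    {K : Set X} (hK : IsCompact K) : ∃ c : ℝ, ∀ x ∈ K, (c : EReal) ≤ E x := by
  rcases K.eq_empty_or_nonempty with rfl | hne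
  · exact ⟨0, fun x hx => hx.elim⟩
  · obtain ⟨x₀, -, hmin⟩ := (hlsc.lowerSemicontinuousOn K).exists_isMinOn hne hK
    exact ⟨(E x₀).toReal, fun x hx => (EReal.coe_toReal_le (hbot x₀)).trans (hmin hx)⟩

lemma tendsto_toReal_of_lowerSemicontinuous_of_le {ι : Type*} {l : Filter ι} {x : ι → X} {x₀ : X}
    {u : ι → ℝ} (hbot : ∀ x, E x ≠ ⊥) (hlsc : LowerSemicontinuous E) (hx : Tendsto x l (𝓝 x₀))
    (hx₀ : E x₀ < ⊤) (hfin : ∀ᶠ i in l, E (x i) < ⊤) (hu : Tendsto u l (𝓝 (E x₀).toReal))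
    (hle : ∀ᶠ i in l, (E (x i)).toReal ≤ u i) :
    Tendsto (fun i => (E (x i)).toReal) l (𝓝 (E x₀).toReal) := by
  refine tendsto_order.2 ⟨fun c hc => ?_, fun c hc => ?_⟩
  · have hc' : (c : EReal) < E x₀ := by
      rwa [← EReal.coe_toReal hx₀.ne (hbot _), EReal.coe_lt_coe_iff]
    filter_upwards [hx.eventually (hlsc x₀ c hc'), hfin] with i hi hi_top
    rw [← EReal.coe_toReal hi_top.ne (hbot _)] at hi
    exact EReal.coe_lt_coe_iff.1 hi
  · filter_upwards [hle, hu.eventually (gt_mem_nhds hc)] with i hi hui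
    exact hi.trans_lt hui

end Energy

section IntervalMeasure

lemma neBot_ae_restrict_Ioc {a b : ℝ} (hab : a < b) : (ae (volume.restrict (Ioc a b))).NeBot :=
  ae_neBot.2 fun h => by
    rw [Measure.restrict_eq_zero, Real.volume_Ioc, ENNReal.ofReal_eq_zero] at h
    linarith

lemma intervalIntegral_pos_of_ae_pos {f : ℝ → ℝ} {a b : ℝ} (hab : a < b)
    (hf : IntervalIntegrable f volume a b) (hpos : ∀ᵐ r ∂volume.restrict (Ioc a b), 0 < f r) :
    0 < ∫ r in a..b, f r := by
  refine (intervalIntegral.integral_pos_iff_support_of_nonneg_ae' ?_ hf).2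
    ⟨hab, pos_iff_ne_zero.2 fun hnull => ?_⟩
  · rw [uIoc_of_le hab.le]
    exact hpos.mono fun r hr => hr.le
  · rw [← Measure.restrict_apply₀' measurableSet_Ioc.nullMeasurableSet] at hnull
    have hzero : ∀ᵐ r ∂volume.restrict (Ioc a b), r ∉ Function.support f :=
      measure_eq_zero_iff_ae_notMem.1 hnull
    have := neBot_ae_restrict_Ioc hab
    obtain ⟨r, hr_pos, hr_zero⟩ := (hpos.and hzero).exists
    exact hr_zero hr_pos.ne'

end IntervalMeasure

namespace IsEVIFlow

variable {X : Type*} [MetricSpace X] {E : X → EReal} {lam : ℝ} {η : ℝ → X}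

lemma ae_lt_top_and_evi_toReal (hbot : ∀ x, E x ≠ ⊥) (h : IsEVIFlow E lam η) {y : X}
    (hy : E y < ⊤) :
    ∀ᵐ t : ℝ, 0 < t → E (η t) < ⊤ ∧
      (1 / 2) * deriv (fun s : ℝ => dist (η s) y ^ 2) t + (lam / 2) * dist (η t) y ^ 2
        + (E (η t)).toReal ≤ (E y).toReal := by
  filter_upwards [(ae_restrict_iff' measurableSet_Ioi).1 (h.evi y)] with t ht ht0
  have hevi := ht ht0
  have hfin : E (η t) < ⊤ := by
    by_contra htop
    rw [not_lt_top_iff.1 htop, EReal.coe_add_top] at hevi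
    exact hy.not_ge hevi
  refine ⟨hfin, ?_⟩
  rw [← EReal.coe_toReal hfin.ne (hbot _), ← EReal.coe_toReal hy.ne (hbot _)] at hevi
  exact_mod_cast hevi

lemma absolutelyContinuousOnInterval_dist_sq (h : IsEVIFlow E lam η) (y : X) {s t : ℝ}
    (hs : 0 < s) (hst : s ≤ t) :
    AbsolutelyContinuousOnInterval (fun r => dist (η r) y ^ 2) s t := by
  have hdist := absolutelyContinuousOnInterval_dist_const (h.locally_ac s t hs hst) y
  simpa only [pow_two] using hdist.fun_mul hdist

lemma intervalIntegrable_toReal (hbot : ∀ x, E x ≠ ⊥) (hlsc : LowerSemicontinuous E)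
    (h : IsEVIFlow E lam η) (hne : (energyDomain E).Nonempty) {s t : ℝ} (hs : 0 < s)
    (hst : s ≤ t) : IntervalIntegrable (fun r => (E (η r)).toReal) volume s t := by
  obtain ⟨y, hy⟩ := hne
  have hcont := continuousOn_of_absolutelyContinuousOnInterval hst (h.locally_ac s t hs hst)
  have hd := h.absolutelyContinuousOnInterval_dist_sq y hs hst
  obtain ⟨c, hc⟩ := exists_real_le_of_isCompact hbot hlsc
    (isCompact_Icc.image_of_continuousOn hcont)
  have hlower : IntervalIntegrable (fun _ : ℝ => c) volume s t := intervalIntegrable_const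
  have hupper : IntervalIntegrable (fun r => (E y).toReal - ((1 / 2) *
      deriv (fun s : ℝ => dist (η s) y ^ 2) r + (lam / 2) * dist (η r) y ^ 2)) volume s t :=
    intervalIntegrable_const.sub ((hd.intervalIntegrable_deriv.const_mul _).add
      (hd.continuousOn.const_mul _).intervalIntegrable)
  have hmeas : AEStronglyMeasurable (fun r => (E (η r)).toReal) (volume.restrict (Ioc s t)) := by
    have hext : Measurable fun r => (E (IccExtend hst ((Icc s t).domRestrict η) r)).toReal :=
      measurable_ereal_toReal.comp (hlsc.comp hcont.domRestrict.Icc_extend').measurable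
    refine ⟨_, hext.stronglyMeasurable, ?_⟩
    filter_upwards [ae_restrict_mem measurableSet_Ioc] with r hr
    rw [IccExtend_of_mem hst _ (Ioc_subset_Icc_self hr), domRestrict_apply]
  rw [intervalIntegrable_iff_integrableOn_Ioc_of_le hst] at hlower hupper ⊢
  refine integrable_of_le_of_le hmeas ?_ ?_ hlower hupper <;>
    refine (ae_restrict_iff' measurableSet_Ioc).2 ?_ <;>
    filter_upwards [h.ae_lt_top_and_evi_toReal hbot hy] with r hr hrs <;>
    obtain ⟨hfin, hevi⟩ := hr (hs.trans hrs.1)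
  · have hcr := hc _ (mem_image_of_mem η (Ioc_subset_Icc_self hrs))
    rwa [← EReal.coe_toReal hfin.ne (hbot _), EReal.coe_le_coe_iff] at hcr
  · linarith

lemma integral_evi (hbot : ∀ x, E x ≠ ⊥) (hlsc : LowerSemicontinuous E)
    (h : IsEVIFlow E lam η) {y : X} (hy : E y < ⊤) {s t : ℝ} (hs : 0 < s) (hst : s ≤ t) :
    Real.exp (lam * (t - s)) / 2 * dist (η t) y ^ 2 - dist (η s) y ^ 2 / 2 ≤
      ∫ r in s..t, Real.exp (lam * (r - s)) * ((E y).toReal - (E (η r)).toReal) := by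
  have hd := h.absolutelyContinuousOnInterval_dist_sq y hs hst
  have hexp : AbsolutelyContinuousOnInterval (fun r => Real.exp (lam * (r - s)) / 2) s t :=
    ContDiffOn.absolutelyContinuousOnInterval (by fun_prop)
  have hprod := hexp.fun_mul hd
  have hderiv : ∀ᵐ r : ℝ, r ∈ uIcc s t →
      deriv (fun r => Real.exp (lam * (r - s)) / 2 * dist (η r) y ^ 2) r =
        Real.exp (lam * (r - s)) * ((1 / 2) * deriv (fun s : ℝ => dist (η s) y ^ 2) r
          + (lam / 2) * dist (η r) y ^ 2) := by
    filter_upwards [hd.ae_differentiableAt] with r hdiff hr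
    have hexp_deriv : HasDerivAt (fun r => Real.exp (lam * (r - s)) / 2)
        (Real.exp (lam * (r - s)) * (lam * 1) / 2) r :=
      ((((hasDerivAt_id r).sub_const s).const_mul lam).exp).div_const 2
    rw [(hexp_deriv.fun_mul (hdiff hr).hasDerivAt).deriv]
    ring
  have hftc := hprod.integral_deriv_eq_sub
  simp only [sub_self, mul_zero, Real.exp_zero] at hftc
  calc Real.exp (lam * (t - s)) / 2 * dist (η t) y ^ 2 - dist (η s) y ^ 2 / 2
      = ∫ r in s..t, deriv (fun r => Real.exp (lam * (r - s)) / 2 * dist (η r) y ^ 2) r := by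
        rw [hftc]; ring
    _ ≤ _ := by
        refine intervalIntegral.integral_mono_ae_restrict hst hprod.intervalIntegrable_deriv
          ((intervalIntegrable_const.sub (h.intervalIntegrable_toReal hbot hlsc ⟨y, hy⟩ hs
            hst)).continuousOn_mul (by fun_prop)) ?_
        refine (ae_restrict_iff' measurableSet_Icc).2 ?_
        filter_upwards [h.ae_lt_top_and_evi_toReal hbot hy, hderiv] with r hevi hderiv_r hr
        rw [hderiv_r (by rwa [uIcc_of_le hst])]
        have hevi_r := (hevi (hs.trans_le hr.1)).2
        gcongr
        linarith

lemma exists_last_le (hlsc : LowerSemicontinuous E) (h : IsEVIFlow E lam η) {s t : ℝ} (hs : 0 < s)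
    (hst : s ≤ t) {c : EReal} (hsc : E (η s) ≤ c) (hct : c < E (η t)) :
    ∃ σ ∈ Ico s t, E (η σ) ≤ c ∧ ∀ r ∈ Ioc σ t, c < E (η r) := by
  have hcont := continuousOn_of_absolutelyContinuousOnInterval hst (h.locally_ac s t hs hst)
  set A : Set ℝ := Icc s t ∩ {r | E (η r) ≤ c}
  have hclosed : IsClosed A := by
    have hA : A = Icc s t ∩ {r | E (IccExtend hst ((Icc s t).domRestrict η) r) ≤ c} := by
      ext r
      refine and_congr_right fun hr => ?_
      rw [mem_ofPred_eq, mem_ofPred_eq, IccExtend_of_mem hst _ hr, domRestrict_apply]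
    rw [hA]
    exact isClosed_Icc.inter ((hlsc.comp hcont.domRestrict.Icc_extend').isClosed_preimage c)
  have hcompact : IsCompact A := isCompact_Icc.of_isClosed_subset hclosed inter_subset_left
  have hσ : sSup A ∈ A := hcompact.sSup_mem ⟨s, left_mem_Icc.2 hst, hsc⟩
  refine ⟨sSup A, ⟨hσ.1.1, hσ.1.2.lt_of_ne fun heq => ?_⟩, hσ.2, fun r hr => ?_⟩
  · exact hct.not_ge (heq ▸ hσ.2)
  · by_contra hrc
    exact hr.1.not_ge (le_csSup hcompact.bddAbove ⟨⟨hσ.1.1.trans hr.1.le, hr.2⟩, not_lt.1 hrc⟩)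

lemma antitoneOn (hbot : ∀ x, E x ≠ ⊥) (hlsc : LowerSemicontinuous E) (h : IsEVIFlow E lam η) :
    AntitoneOn (fun t => E (η t)) (Ioi 0) := by
  intro s (hs : 0 < s) t _ hst
  by_contra! hlt
  obtain ⟨σ, hσ, hσ_le, hgt⟩ := h.exists_last_le hlsc hs hst le_rfl hlt
  have hσ0 : 0 < σ := hs.trans_le hσ.1
  have hEσ : E (η σ) < ⊤ := hσ_le.trans_lt (hlt.trans_le le_top)
  set f : ℝ → ℝ := fun r => Real.exp (lam * (r - σ)) * ((E (η r)).toReal - (E (η σ)).toReal)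
  have hf_int : IntervalIntegrable f volume σ t :=
    ((h.intervalIntegrable_toReal hbot hlsc ⟨_, hEσ⟩ hσ0 hσ.2.le).sub
      intervalIntegrable_const).continuousOn_mul (by fun_prop)
  have hf_pos : ∀ᵐ r ∂volume.restrict (Ioc σ t), 0 < f r := by
    refine (ae_restrict_iff' measurableSet_Ioc).2 ?_
    filter_upwards [h.ae_lt_top_and_evi_toReal hbot hEσ] with r hr hrs
    have hEr := (hr (hσ0.trans hrs.1)).1
    have hlt : E (η σ) < E (η r) := hσ_le.trans_lt (hgt r hrs)
    rw [← EReal.coe_toReal hEσ.ne (hbot _), ← EReal.coe_toReal hEr.ne (hbot _),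
      EReal.coe_lt_coe_iff] at hlt
    exact mul_pos (Real.exp_pos _) (sub_pos.2 hlt)
  have hf_integral : ∫ r in σ..t, f r ≤ 0 := by
    have hevi := h.integral_evi hbot hlsc hEσ hσ0 hσ.2.le
    have hneg : ∫ r in σ..t, f r = -∫ r in σ..t,
        Real.exp (lam * (r - σ)) * ((E (η σ)).toReal - (E (η r)).toReal) := by
      simp only [f, ← intervalIntegral.integral_neg, ← mul_neg, neg_sub]
    rw [dist_self, zero_pow two_ne_zero, zero_div, sub_zero] at hevi
    rw [hneg, neg_nonpos]
    exact le_trans (by positivity) hevi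
  exact hf_integral.not_gt (intervalIntegral_pos_of_ae_pos hσ.2 hf_int hf_pos)

lemma lt_top (hbot : ∀ x, E x ≠ ⊥) (hlsc : LowerSemicontinuous E) (h : IsEVIFlow E lam η)
    (hne : (energyDomain E).Nonempty) {t : ℝ} (ht : 0 < t) : E (η t) < ⊤ := by
  obtain ⟨y, hy⟩ := hne
  have hae : ∀ᵐ r ∂volume.restrict (Ioc 0 t), E (η r) < ⊤ := by
    refine (ae_restrict_iff' measurableSet_Ioc).2 ?_
    filter_upwards [h.ae_lt_top_and_evi_toReal hbot hy] with r hr hrt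
    exact (hr hrt.1).1
  have := neBot_ae_restrict_Ioc ht
  obtain ⟨r, hr, hrt⟩ := (hae.and (ae_restrict_mem measurableSet_Ioc)).exists
  exact (h.antitoneOn hbot hlsc hrt.1 ht hrt.2).trans_lt hr

end IsEVIFlow

/-- The consequences of the evolution variational inequality that are stable under limits: a
continuous curve on `[0, ∞)` along which the energy is finite and decreasing at positive times, and
which satisfies the inequality integrated in time, with integrating factor `e^{λ (r - s)}`. The
energy of the starting point `η 0` may be infinite. -/
structure IsIntegralEVIFlow {X : Type*} [MetricSpace X] (E : X → EReal) (lam : ℝ) (η : ℝ → X) :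
    Prop where
  continuousOn : ContinuousOn η (Ici 0)
  lt_top : ∀ t, 0 < t → E (η t) < ⊤
  antitoneOn : AntitoneOn (fun t => E (η t)) (Ioi 0)
  integral_evi : ∀ y s t, 0 < s → s ≤ t → E y < ⊤ →
    Real.exp (lam * (t - s)) / 2 * dist (η t) y ^ 2 - dist (η s) y ^ 2 / 2 ≤
      ∫ r in s..t, Real.exp (lam * (r - s)) * ((E y).toReal - (E (η r)).toReal)

namespace IsIntegralEVIFlow

variable {X : Type*} [MetricSpace X] {E : X → EReal} {lam : ℝ} {η ξ : ℝ → X}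

lemma tendsto_nhdsGT (h : IsIntegralEVIFlow E lam η) {s : ℝ} (hs : 0 ≤ s) :
    Tendsto η (𝓝[>] s) (𝓝 (η s)) :=
  (h.continuousOn s hs).mono_left (nhdsWithin_mono _ fun _ hr => hs.trans (le_of_lt hr))

lemma toReal_antitoneOn (hbot : ∀ x, E x ≠ ⊥) (h : IsIntegralEVIFlow E lam η) :
    AntitoneOn (fun t => (E (η t)).toReal) (Ioi 0) := fun s hs _ ht hst =>
  EReal.toReal_le_toReal (h.antitoneOn hs ht hst) (hbot _) (h.lt_top s hs).ne

lemma intervalIntegrable (hbot : ∀ x, E x ≠ ⊥) (h : IsIntegralEVIFlow E lam η) {s t : ℝ}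
    (hs : 0 < s) (hst : s ≤ t) : IntervalIntegrable (fun r => (E (η r)).toReal) volume s t :=
  AntitoneOn.intervalIntegrable <| (h.toReal_antitoneOn hbot).mono <| by
    rw [uIcc_of_le hst]
    exact fun r hr => hs.trans_le hr.1

lemma shift (h : IsIntegralEVIFlow E lam η) {a : ℝ} (ha : 0 ≤ a) :
    IsIntegralEVIFlow E lam fun t => η (a + t) where
  continuousOn := h.continuousOn.comp (Continuous.continuousOn (by fun_prop))
    fun t (ht : 0 ≤ t) => mem_Ici.2 (add_nonneg ha ht)
  lt_top t ht := h.lt_top _ (by linarith)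
  antitoneOn s hs t ht hst := h.antitoneOn (mem_Ioi.2 (add_pos_of_nonneg_of_pos ha hs))
    (mem_Ioi.2 (add_pos_of_nonneg_of_pos ha ht)) (by linarith)
  integral_evi y s t hs hst hy := by
    have hevi := h.integral_evi y (a + s) (a + t) (by linarith) (by linarith) hy
    rw [← intervalIntegral.integral_comp_add_left] at hevi
    simpa only [add_sub_add_left_eq_sub] using hevi

lemma exp_mul_dist_sq_sub_le (hbot : ∀ x, E x ≠ ⊥) (h : IsIntegralEVIFlow E lam η) {s t : ℝ}
    (hs : 0 < s) (hst : s ≤ t) {y : X} (hy : E y < ⊤) :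
    Real.exp (lam * (t - s)) / 2 * dist (η t) y ^ 2 - dist (η s) y ^ 2 / 2 ≤
      (t - s) * expMean (lam * (t - s)) * ((E y).toReal - (E (η t)).toReal) := by
  refine (h.integral_evi y s t hs hst hy).trans ?_
  rw [← integral_exp_mul_sub, ← intervalIntegral.integral_mul_const]
  refine intervalIntegral.integral_mono_on hst
    ((intervalIntegrable_const.sub (h.intervalIntegrable hbot hs hst)).continuousOn_mul
      (by fun_prop)) (Continuous.intervalIntegrable (by fun_prop) _ _) fun r hr => ?_
  have henergy : (E (η t)).toReal ≤ (E (η r)).toReal :=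
    h.toReal_antitoneOn hbot (hs.trans_le hr.1) (hs.trans_le hst) hr.2
  gcongr

lemma tendsto_toReal (hbot : ∀ x, E x ≠ ⊥) (hlsc : LowerSemicontinuous E)
    (h : IsIntegralEVIFlow E lam η) {s : ℝ} (hs : 0 < s) :
    Tendsto (fun r => (E (η r)).toReal) (𝓝[>] s) (𝓝 (E (η s)).toReal) := by
  refine tendsto_toReal_of_lowerSemicontinuous_of_le hbot hlsc (h.tendsto_nhdsGT hs.le)
    (h.lt_top s hs) ?_ tendsto_const_nhds ?_ <;> filter_upwards [self_mem_nhdsWithin] with r hr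
  · exact h.lt_top r (hs.trans hr)
  · exact h.toReal_antitoneOn hbot hs (hs.trans hr) (le_of_lt hr)

lemma sq_exp_mul_dist_sub_le (hbot : ∀ x, E x ≠ ⊥) (hη : IsIntegralEVIFlow E lam η)
    (hξ : IsIntegralEVIFlow E lam ξ) {s t : ℝ} (hs : 0 < s) (hst : s ≤ t) :
    (Real.exp (lam * t) * dist (η t) (ξ t)) ^ 2 - (Real.exp (lam * s) * dist (η s) (ξ s)) ^ 2 ≤
      (t - s) * (2 * Real.exp (lam * s) ^ 2 * expMean (lam * (t - s)) *
        ((Real.exp (lam * (t - s)) - 1) * ((E (ξ t)).toReal - (E (η t)).toReal)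
          + ((E (η s)).toReal - (E (η t)).toReal))) := by
  set e := Real.exp (lam * (t - s))
  have he : Real.exp (lam * t) = Real.exp (lam * s) * e := by
    rw [← Real.exp_add]
    ring_nf
  have hηξ := mul_le_mul_of_nonneg_left
    (hη.exp_mul_dist_sq_sub_le hbot hs hst (hξ.lt_top t (hs.trans_le hst)))
    (Real.exp_pos (lam * (t - s))).le
  have hξη := hξ.exp_mul_dist_sq_sub_le hbot hs hst (hη.lt_top s hs)
  rw [dist_comm (ξ t), dist_comm (ξ s)] at hξη
  have hsum := mul_le_mul_of_nonneg_left (add_le_add hηξ hξη)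
    (mul_nonneg zero_le_two (sq_nonneg (Real.exp (lam * s))))
  rw [he]
  linarith

lemma exp_mul_dist_le_of_pos (hbot : ∀ x, E x ≠ ⊥) (hlsc : LowerSemicontinuous E)
    (hη : IsIntegralEVIFlow E lam η) (hξ : IsIntegralEVIFlow E lam ξ) {s t : ℝ} (hs : 0 < s)
    (hst : s ≤ t) :
    Real.exp (lam * t) * dist (η t) (ξ t) ≤ Real.exp (lam * s) * dist (η s) (ξ s) := by
  set G : ℝ → ℝ := fun r => (Real.exp (lam * r) * dist (η r) (ξ r)) ^ 2
  have hG : ContinuousOn G (Icc s t) := by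
    have hsub : Icc s t ⊆ Ici 0 := fun r hr => hs.le.trans hr.1
    exact (ContinuousOn.mul (by fun_prop) (continuous_dist.comp_continuousOn
      ((hη.continuousOn.mono hsub).prodMk (hξ.continuousOn.mono hsub)))).pow 2
  suffices G t ≤ G s from le_of_sq_le_sq this (by positivity)
  refine image_le_of_liminf_slope_right_le_deriv_boundary (B := fun _ => G s) (B' := fun _ => 0)
    hG le_rfl continuousOn_const (fun x _ => hasDerivWithinAt_const _ _ _)
    (fun x hx c hc => Eventually.frequently ?_) (right_mem_Icc.2 hst)
  have hx : 0 < x := hs.trans_le hx.1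
  have hsub : Tendsto (fun z : ℝ => lam * (z - x)) (𝓝[>] x) (𝓝 0) :=
    (Continuous.tendsto' (by fun_prop) x 0 (by ring)).mono_left nhdsWithin_le_nhds
  have hEη := hη.tendsto_toReal hbot hlsc hx
  have hEξ := hξ.tendsto_toReal hbot hlsc hx
  have hlim := (((continuous_expMean.tendsto _).comp hsub).const_mul
    (2 * Real.exp (lam * x) ^ 2)).mul (((((Real.continuous_exp.tendsto _).comp hsub).sub_const
      1).mul (hEξ.sub hEη)).add (hEη.const_sub (E (η x)).toReal))
  rw [Real.exp_zero, sub_self, zero_mul, zero_add, sub_self, mul_zero] at hlim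
  filter_upwards [hlim.eventually (gt_mem_nhds hc), self_mem_nhdsWithin] with z hz hxz
  rw [slope_def_field]
  exact ((div_le_iff₀' (sub_pos.2 hxz)).2
    (hη.sq_exp_mul_dist_sub_le hbot hξ hx (le_of_lt hxz))).trans_lt hz

lemma exp_mul_dist_le (hbot : ∀ x, E x ≠ ⊥) (hlsc : LowerSemicontinuous E)
    (hη : IsIntegralEVIFlow E lam η) (hξ : IsIntegralEVIFlow E lam ξ) {t : ℝ} (ht : 0 ≤ t) :
    Real.exp (lam * t) * dist (η t) (ξ t) ≤ dist (η 0) (ξ 0) := by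
  rcases ht.eq_or_lt with rfl | ht
  · simp
  have hexp : Tendsto (fun s : ℝ => Real.exp (lam * s)) (𝓝[>] 0) (𝓝 1) :=
    (Continuous.tendsto' (by fun_prop) 0 1 (by simp)).mono_left nhdsWithin_le_nhds
  have hlim := hexp.mul ((hη.tendsto_nhdsGT le_rfl).dist (hξ.tendsto_nhdsGT le_rfl))
  rw [one_mul] at hlim
  refine ge_of_tendsto hlim ?_
  filter_upwards [Ioo_mem_nhdsGT ht] with s hs
  exact hη.exp_mul_dist_le_of_pos hbot hlsc hξ hs.1 hs.2.le

end IsIntegralEVIFlow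

section Semigroup

variable {X : Type*} [MetricSpace X] {E : X → EReal} {lam : ℝ} {x : X} {η : ℝ → X}

@[simp] lemma eviSemigroup_zero : eviSemigroup E lam 0 x = x :=
  dif_neg fun h => absurd h.1 (lt_irrefl 0)

lemma exists_eviSemigroup_eq (hη : IsEVIFlowFrom E lam x η) :
    ∃ ξ, IsEVIFlowFrom E lam x ξ ∧ ∀ t, 0 < t → eviSemigroup E lam t x = ξ t :=
  have hex : ∃ η, IsEVIFlowFrom E lam x η := ⟨η, hη⟩
  ⟨hex.choose, hex.choose_spec, fun _ ht => dif_pos ⟨ht, hex⟩⟩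

lemma IsEVIFlowFrom.continuousOn_eviSemigroup (hη : IsEVIFlowFrom E lam x η) :
    ContinuousOn (fun t => eviSemigroup E lam t x) (Ici 0) := by
  obtain ⟨ξ, hξ, heq⟩ := exists_eviSemigroup_eq hη
  intro t ht
  rcases (mem_Ici.1 ht).eq_or_lt with rfl | ht
  · rw [← continuousWithinAt_Ioi_iff_Ici, ContinuousWithinAt, eviSemigroup_zero]
    exact hξ.tendsto.congr' (eventually_nhdsWithin_of_forall fun s hs => (heq s hs).symm)
  · have hac := hξ.isEVIFlow.locally_ac (t / 2) (t + 1) (by linarith) (by linarith)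
    have hcont : ContinuousAt ξ t :=
      (continuousOn_of_absolutelyContinuousOnInterval (by linarith) hac).continuousAt
        (Icc_mem_nhds (by linarith) (by linarith))
    refine (hcont.congr ?_).continuousWithinAt
    filter_upwards [Ioi_mem_nhds ht] with s hs using (heq s hs).symm

lemma IsEVIFlowFrom.isIntegralEVIFlow_eviSemigroup (hbot : ∀ x, E x ≠ ⊥)
    (hlsc : LowerSemicontinuous E) (hη : IsEVIFlowFrom E lam x η) :
    IsIntegralEVIFlow E lam fun t => eviSemigroup E lam t x := by
  obtain ⟨ξ, hξ, heq⟩ := exists_eviSemigroup_eq hη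
  have hflow := hξ.isEVIFlow
  refine ⟨hη.continuousOn_eviSemigroup, fun t ht => ?_, fun s hs t ht hst => ?_,
    fun y s t hs hst hy => ?_⟩
  · rw [heq t ht]
    exact hflow.lt_top hbot hlsc (closure_nonempty_iff.1 ⟨x, hξ.mem_closure⟩) ht
  · simp only [heq s hs, heq t ht]
    exact hflow.antitoneOn hbot hlsc hs ht hst
  · rw [heq s hs, heq t (hs.trans_le hst)]
    refine (hflow.integral_evi hbot hlsc hy hs hst).trans_eq
      (intervalIntegral.integral_congr fun r hr => ?_)
    rw [uIcc_of_le hst] at hr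
    simp only [heq r (hs.trans_le hr.1)]

end Semigroup

section GlobalSlope

variable {X : Type*} [MetricSpace X] {E : X → EReal} {lam : ℝ} {x : X}

/-- The global slope `sup_y [E(x) - E(y) + (λ/2) d²(x, y)]⁺ / d(x, y)`, with `y` ranging over the
domain of `E`. It dominates the metric slope and, unlike it, is lower semicontinuous along curves
of continuous energy. The term `y = x` contributes `0 / 0 = 0`; the value is junk if
`E x = +∞`. -/
noncomputable def globalSlope (E : X → EReal) (lam : ℝ) (x : X) : ℝ≥0∞ :=
  ⨆ y ∈ energyDomain E,
    ENNReal.ofReal ((E x).toReal - (E y).toReal + lam / 2 * dist x y ^ 2) / edist x y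

lemma globalSlope_le_ofReal_iff {p : ℝ} (hp : 0 ≤ p) :
    globalSlope E lam x ≤ ENNReal.ofReal p ↔ ∀ y ∈ energyDomain E,
      (E x).toReal - (E y).toReal + lam / 2 * dist x y ^ 2 ≤ p * dist x y := by
  refine iSup₂_le_iff.trans (forall₂_congr fun y _ => ?_)
  rcases eq_or_ne x y with rfl | hxy
  · simp
  · rw [ENNReal.div_le_iff (edist_pos.2 hxy).ne' (edist_ne_top x y), edist_dist,
      ← ENNReal.ofReal_mul hp, ENNReal.ofReal_le_ofReal_iff (by positivity)]

lemma toENNReal_sub_div_edist_le (hbot : ∀ x, E x ≠ ⊥) (hx : E x < ⊤) {y : X} (hxy : x ≠ y) :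
    (E x - E y).toENNReal / edist x y ≤
      globalSlope E lam x + ENNReal.ofReal (|lam| / 2 * dist x y) := by
  rcases eq_or_ne (E y) ⊤ with hy | hy
  · simp [hy]
  have hdist : ENNReal.ofReal (|lam| / 2 * dist x y) =
      ENNReal.ofReal (|lam| / 2 * dist x y ^ 2) / edist x y := by
    rw [edist_dist, ← ENNReal.ofReal_div_of_pos (dist_pos.2 hxy)]
    congr 1
    have := dist_pos.2 hxy
    field_simp
  have hconv : -(|lam| / 2 * dist x y ^ 2) ≤ lam / 2 * dist x y ^ 2 := by
    rw [← neg_mul, ← neg_div]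
    gcongr
    exact neg_abs_le lam
  calc (E x - E y).toENNReal / edist x y
      = ENNReal.ofReal ((E x).toReal - (E y).toReal) / edist x y := by
        rw [← EReal.coe_toReal hx.ne (hbot x), ← EReal.coe_toReal hy (hbot y), ← EReal.coe_sub,
          EReal.toENNReal_of_ne_top (EReal.coe_ne_top _)]
        simp only [EReal.toReal_coe]
    _ ≤ (ENNReal.ofReal ((E x).toReal - (E y).toReal + lam / 2 * dist x y ^ 2)
          + ENNReal.ofReal (|lam| / 2 * dist x y ^ 2)) / edist x y := by
        gcongr
        refine (ENNReal.ofReal_le_ofReal ?_).trans ENNReal.ofReal_add_le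
        linarith
    _ ≤ globalSlope E lam x + ENNReal.ofReal (|lam| / 2 * dist x y) := by
        rw [ENNReal.add_div, ← hdist]
        gcongr
        exact le_iSup₂ (f := fun y (_ : y ∈ energyDomain E) => ENNReal.ofReal
          ((E x).toReal - (E y).toReal + lam / 2 * dist x y ^ 2) / edist x y) y
          (lt_top_iff_ne_top.2 hy)

lemma metricSlope_le_globalSlope (hbot : ∀ x, E x ≠ ⊥) (hx : E x < ⊤) :
    metricSlope E x ≤ globalSlope E lam x := by
  rw [metricSlope, if_pos (show x ∈ energyDomain E from hx)]
  rcases (𝓝[≠] x).eq_or_neBot with hisolated | hne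
  · simp [hisolated]
  have hdist : Tendsto (fun y => |lam| / 2 * dist x y) (𝓝[≠] x) (𝓝 0) :=
    (Continuous.tendsto' (by fun_prop) x 0 (by simp)).mono_left nhdsWithin_le_nhds
  have hlim := (ENNReal.tendsto_ofReal hdist).const_add (globalSlope E lam x)
  rw [ENNReal.ofReal_zero, add_zero] at hlim
  rw [← hlim.limsup_eq]
  refine limsup_le_limsup ?_
  filter_upwards [self_mem_nhdsWithin] with y hy
  exact toENNReal_sub_div_edist_le hbot hx (Ne.symm hy)

lemma lowerSemicontinuousAt_globalSlope {β : ℝ → X} {t : ℝ} (hβ : ContinuousAt β t)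
    (hE : ContinuousAt (fun s => (E (β s)).toReal) t) :
    LowerSemicontinuousAt (fun s => globalSlope E lam (β s)) t := by
  refine lowerSemicontinuousAt_biSup fun y _ => lowerSemicontinuousAt_ennreal_div
    (ContinuousAt.lowerSemicontinuousAt ?_) (hβ.edist continuousAt_const) fun s => edist_ne_top _ _
  exact ENNReal.continuous_ofReal.continuousAt.comp
    ((hE.sub_const _).add (((hβ.dist continuousAt_const).pow 2).const_mul _))

end GlobalSlope

lemma mul_sub_le_sub_of_antitoneOn {f : ℝ → ℝ} {a b c : ℝ} (hab : a ≤ b)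
    (hf : AntitoneOn f (Icc a b))
    (hc : ∀ x ∈ Ioo a b, DifferentiableAt ℝ f x → c ≤ -deriv f x) : c * (b - a) ≤ f a - f b := by
  have hmono : MonotoneOn (-f) (uIcc a b) := by
    rw [uIcc_of_le hab]
    exact hf.neg
  have hint := hmono.intervalIntegral_deriv_mem_uIcc
  have hle : (-f) a ≤ (-f) b := hmono left_mem_uIcc right_mem_uIcc hab
  rw [uIcc_of_le (sub_nonneg.2 hle)] at hint
  calc c * (b - a) = ∫ _ in a..b, c := by simp [mul_comm]
    _ ≤ ∫ x in a..b, deriv (-f) x := by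
        refine intervalIntegral.integral_mono_ae_restrict hab intervalIntegrable_const
          hmono.intervalIntegrable_deriv ?_
        rw [← restrict_Ioo_eq_restrict_Icc]
        refine (ae_restrict_iff' measurableSet_Ioo).2 ?_
        filter_upwards [hf.neg.ae_differentiableWithinAt_of_mem] with x hx hxab
        have hdiff := (hx (Ioo_subset_Icc_self hxab)).differentiableAt
          (Icc_mem_nhds hxab.1 hxab.2)
        rw [deriv.neg]
        exact hc x hxab (differentiableAt_neg_iff.1 hdiff)
    _ ≤ (-f) b - (-f) a := hint.2
    _ = f a - f b := by simp only [Pi.neg_apply]; ring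

lemma exists_gt_forall_sub_le_mul_sub {f : ℝ → ℝ} {s c : ℝ} (hf : DifferentiableAt ℝ f s)
    (hc : -deriv f s < c) : ∃ u > s, ∀ r ∈ Ico s u, f s - f r ≤ c * (r - s) := by
  have hslope := (hasDerivAt_iff_tendsto_slope.1 hf.hasDerivAt).mono_left
    (nhdsWithin_mono s fun _ hr => ne_of_gt (mem_Ioi.1 hr))
  obtain ⟨u, hu, hlt⟩ := (mem_nhdsGT_iff_exists_Ioo_subset' (lt_add_one s)).1
    (hslope.eventually (lt_mem_nhds (neg_lt.1 hc)))
  refine ⟨u, hu, fun r ⟨hsr, hru⟩ => ?_⟩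
  rcases hsr.eq_or_lt with rfl | hsr
  · simp
  · have hr : -c < slope f s r := hlt ⟨hsr, hru⟩
    rw [slope_def_field, lt_div_iff₀ (sub_pos.2 hsr)] at hr
    linarith

namespace IsIntegralEVIFlow

variable {X : Type*} [MetricSpace X] {E : X → EReal} {lam : ℝ} {η : ℝ → X}

lemma globalSlope_le_of_frequently_dist_le (hbot : ∀ x, E x ≠ ⊥) (hlsc : LowerSemicontinuous E)
    (h : IsIntegralEVIFlow E lam η) {s p : ℝ} (hs : 0 < s) (hp : 0 ≤ p)
    (hdist : ∃ᶠ δ in 𝓝[>] 0, dist (η s) (η (s + δ)) ≤ p * δ) :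
    globalSlope E lam (η s) ≤ ENNReal.ofReal p := by
  refine (globalSlope_le_ofReal_iff hp).2 fun y hy => ?_
  set d := dist (η s) y
  have hlam : Tendsto (fun δ => lam * δ) (𝓝[>] 0) (𝓝 0) :=
    (Continuous.tendsto' (by fun_prop) 0 0 (mul_zero lam)).mono_left nhdsWithin_le_nhds
  have hright : Tendsto (fun δ => s + δ) (𝓝[>] 0) (𝓝[>] s) :=
    tendsto_nhdsWithin_iff.2 ⟨(Continuous.tendsto' (by fun_prop) 0 s (add_zero s)).mono_left
      nhdsWithin_le_nhds, eventually_nhdsWithin_of_forall fun _ hδ => lt_add_of_pos_right s hδ⟩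
  have hlower := ((continuous_expMean.tendsto 0).comp hlam).mul
    ((((h.tendsto_toReal hbot hlsc hs).comp hright).sub_const (E y).toReal).add_const
      (lam / 2 * d ^ 2))
  have hupper := ((Real.continuous_exp.tendsto 0).comp hlam).mul_const (p * d)
  rw [expMean_zero, one_mul] at hlower
  rw [Real.exp_zero, one_mul] at hupper
  refine le_of_tendsto_of_tendsto_of_frequently hlower hupper ?_
  refine (hdist.and_eventually self_mem_nhdsWithin).mono
    fun δ ⟨hδ, (hδ_pos : 0 < δ)⟩ => ?_
  have htri : d ≤ dist (η (s + δ)) y + p * δ :=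
    (dist_triangle _ (η (s + δ)) _).trans (by linarith only [hδ])
  have hsq : d ^ 2 - 2 * d * (p * δ) ≤ dist (η (s + δ)) y ^ 2 := by
    nlinarith [sq_nonneg (dist (η (s + δ)) y - d), dist_nonneg (x := η s) (y := y)]
  have hbound := h.exp_mul_dist_sq_sub_le hbot hs (le_add_of_nonneg_right hδ_pos.le) hy
  rw [add_sub_cancel_left] at hbound
  have hexp_sq := mul_le_mul_of_nonneg_left hsq (half_pos (Real.exp_pos (lam * δ))).le
  have hexp := mul_expMean (lam * δ)
  refine le_of_mul_le_mul_left ?_ hδ_pos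
  simp only [Function.comp_apply]
  linear_combination hbound + hexp_sq + d ^ 2 / 2 * hexp

lemma eventually_dist_sq_le (hbot : ∀ x, E x ≠ ⊥) (h : IsIntegralEVIFlow E lam η) {s c : ℝ}
    (hs : 0 < s) (hdiff : DifferentiableAt ℝ (fun t => (E (η t)).toReal) s)
    (hc : -deriv (fun t => (E (η t)).toReal) s < c) :
    ∀ᶠ δ in 𝓝[>] 0, dist (η s) (η (s + δ)) ^ 2 ≤ c * δ ^ 2 := by
  set F : ℝ → ℝ := fun t => (E (η t)).toReal
  obtain ⟨c₀, hc₀, hc₀c⟩ := exists_between hc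
  obtain ⟨u, hu, hdecrease⟩ := exists_gt_forall_sub_le_mul_sub hdiff hc₀
  have hconst : ∀ᶠ δ in 𝓝[>] (0 : ℝ), Real.exp ((|lam| - lam) * δ) * c₀ < c :=
    (((Continuous.tendsto' (by fun_prop) 0 c₀ (by simp)).mono_left
      nhdsWithin_le_nhds).eventually (gt_mem_nhds hc₀c))
  filter_upwards [hconst, Ioo_mem_nhdsGT (sub_pos.2 hu)] with δ hδc ⟨hδ, hδu⟩
  refine le_trans ?_ (mul_le_mul_of_nonneg_right hδc.le (sq_nonneg δ))
  have hevi := h.integral_evi (η s) s (s + δ) hs (by linarith) (h.lt_top s hs)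
  rw [dist_self, add_sub_cancel_left, dist_comm] at hevi
  have hbound : ∫ r in s..(s + δ), Real.exp (lam * (r - s)) * (F s - F r) ≤
      ∫ r in s..(s + δ), Real.exp (|lam| * δ) * (c₀ * (r - s)) := by
    refine intervalIntegral.integral_mono_on (by linarith) ((intervalIntegrable_const.sub
      (h.intervalIntegrable hbot hs (by linarith))).continuousOn_mul (by fun_prop))
      (Continuous.intervalIntegrable (by fun_prop) _ _) fun r ⟨hsr, hr⟩ => ?_
    have hnonneg : 0 ≤ F s - F r :=
      sub_nonneg.2 (h.toReal_antitoneOn hbot hs (hs.trans_le hsr) hsr)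
    have hlinear := hdecrease r ⟨hsr, by linarith⟩
    have hexp : lam * (r - s) ≤ |lam| * δ :=
      mul_le_mul (le_abs_self lam) (by linarith) (by linarith) (abs_nonneg lam)
    gcongr
  have hintegral : ∫ r in s..(s + δ), Real.exp (|lam| * δ) * (c₀ * (r - s)) =
      Real.exp (|lam| * δ) * c₀ * δ ^ 2 / 2 := by
    rw [intervalIntegral.integral_const_mul, intervalIntegral.integral_const_mul,
      intervalIntegral.integral_comp_sub_right (fun r => r) s, integral_id]
    ring
  rw [sub_mul, Real.exp_sub, div_mul_eq_mul_div, div_mul_eq_mul_div,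
    le_div_iff₀ (Real.exp_pos _)]
  linarith

lemma exp_mul_dist_le_dist (hbot : ∀ x, E x ≠ ⊥) (hlsc : LowerSemicontinuous E)
    (h : IsIntegralEVIFlow E lam η) {s b δ : ℝ} (hs : 0 ≤ s) (hsb : s ≤ b) (hδ : 0 ≤ δ) :
    Real.exp (lam * (b - s)) * dist (η b) (η (b + δ)) ≤ dist (η s) (η (s + δ)) := by
  have hdist := (h.shift hs).exp_mul_dist_le hbot hlsc (h.shift (add_nonneg hs hδ))
    (sub_nonneg.2 hsb)
  simpa only [add_zero, add_sub_cancel, add_right_comm s δ] using hdist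

lemma exp_mul_sq_le_neg_deriv (hbot : ∀ x, E x ≠ ⊥) (hlsc : LowerSemicontinuous E)
    (h : IsIntegralEVIFlow E lam η) {s b p : ℝ} (hs : 0 < s) (hsb : s ≤ b)
    (hdiff : DifferentiableAt ℝ (fun t => (E (η t)).toReal) s) (hp : 0 ≤ p)
    (hslope : ENNReal.ofReal p ≤ globalSlope E lam (η b)) :
    Real.exp (-(2 * |lam| * (b - s))) * p ^ 2 ≤ -deriv (fun t => (E (η t)).toReal) s := by
  refine le_of_forall_gt_imp_ge_of_dense fun c hc => ?_
  have hdist := h.eventually_dist_sq_le hbot hs hdiff hc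
  have hc_nonneg : 0 ≤ c := by
    obtain ⟨δ, hδ, hδ_pos⟩ := (hdist.and self_mem_nhdsWithin).exists
    exact nonneg_of_mul_nonneg_left ((sq_nonneg _).trans hδ) (pow_pos hδ_pos 2)
  have hslope_le : globalSlope E lam (η b) ≤
      ENNReal.ofReal (Real.exp (|lam| * (b - s)) * √c) := by
    refine h.globalSlope_le_of_frequently_dist_le hbot hlsc (hs.trans_le hsb) (by positivity)
      (Eventually.frequently ?_)
    filter_upwards [hdist, self_mem_nhdsWithin] with δ hδ hδ_pos
    have hδ_pos : 0 < δ := hδ_pos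
    have hlow : Real.exp (-(|lam| * (b - s))) ≤ Real.exp (lam * (b - s)) := by
      rw [← neg_mul]
      gcongr
      exact neg_abs_le lam
    calc dist (η b) (η (b + δ))
        = Real.exp (|lam| * (b - s)) *
            (Real.exp (-(|lam| * (b - s))) * dist (η b) (η (b + δ))) := by
          rw [← mul_assoc, ← Real.exp_add, add_neg_cancel, Real.exp_zero, one_mul]
      _ ≤ Real.exp (|lam| * (b - s)) * dist (η s) (η (s + δ)) := by
          gcongr
          exact (mul_le_mul_of_nonneg_right hlow dist_nonneg).trans
            (h.exp_mul_dist_le_dist hbot hlsc hs.le hsb hδ_pos.le)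
      _ ≤ Real.exp (|lam| * (b - s)) * (√c * δ) := by
          gcongr
          refine le_of_sq_le_sq ?_ (by positivity)
          rwa [mul_pow, Real.sq_sqrt hc_nonneg]
      _ = Real.exp (|lam| * (b - s)) * √c * δ := by ring
  have hp_le := (ENNReal.ofReal_le_ofReal_iff (by positivity)).1 (hslope.trans hslope_le)
  calc Real.exp (-(2 * |lam| * (b - s))) * p ^ 2
      ≤ Real.exp (-(2 * |lam| * (b - s))) * (Real.exp (|lam| * (b - s)) * √c) ^ 2 := by gcongr
    _ = c := by
        rw [mul_pow, Real.sq_sqrt hc_nonneg, ← Real.exp_nat_mul, ← mul_assoc, ← Real.exp_add]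
        simp [mul_assoc]

lemma le_dissipation (hbot : ∀ x, E x ≠ ⊥) (hlsc : LowerSemicontinuous E)
    (h : IsIntegralEVIFlow E lam η) {a b p : ℝ} (ha : 0 < a) (hab : a ≤ b) (hp : 0 ≤ p)
    (hslope : ENNReal.ofReal p ≤ globalSlope E lam (η b)) :
    Real.exp (-(2 * |lam| * (b - a))) * p ^ 2 * (b - a) ≤
      (E (η a)).toReal - (E (η b)).toReal := by
  refine mul_sub_le_sub_of_antitoneOn (f := fun t => (E (η t)).toReal) hab
    ((h.toReal_antitoneOn hbot).mono fun s hs => ha.trans_le hs.1) fun s hs hdiff => ?_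
  refine le_trans ?_ (h.exp_mul_sq_le_neg_deriv hbot hlsc (ha.trans hs.1) hs.2.le hdiff hp hslope)
  have := hs.1.le
  gcongr

lemma le_exp_mul_dissipation (hbot : ∀ x, E x ≠ ⊥) (hlsc : LowerSemicontinuous E)
    (h : IsIntegralEVIFlow E lam η) {a r b p : ℝ} (ha : 0 < a) (har : a ≤ r) (hrb : r ≤ b)
    (hp : 0 ≤ p) (hslope : ENNReal.ofReal p ≤ globalSlope E lam (η b)) :
    Real.exp (-(3 * |lam| * (b - a))) * p ^ 2 * (b - r) ≤
      Real.exp (lam * (r - a)) * ((E (η r)).toReal - (E (η b)).toReal) := by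
  have hexp : Real.exp (-(3 * |lam| * (b - a))) ≤
      Real.exp (lam * (r - a)) * Real.exp (-(2 * |lam| * (b - r))) := by
    rw [← Real.exp_add]
    refine Real.exp_le_exp.2 ?_
    nlinarith [mul_nonneg (abs_nonneg lam) (sub_nonneg.2 har),
      mul_nonneg (abs_nonneg lam) (sub_nonneg.2 hrb),
      mul_le_mul_of_nonneg_right (neg_abs_le lam) (sub_nonneg.2 har)]
  have : 0 ≤ b - r := sub_nonneg.2 hrb
  calc Real.exp (-(3 * |lam| * (b - a))) * p ^ 2 * (b - r)
      ≤ Real.exp (lam * (r - a)) * Real.exp (-(2 * |lam| * (b - r))) * p ^ 2 * (b - r) := by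
        gcongr
    _ = Real.exp (lam * (r - a)) * (Real.exp (-(2 * |lam| * (b - r))) * p ^ 2 * (b - r)) := by
        ring
    _ ≤ _ := by
        gcongr
        exact h.le_dissipation hbot hlsc (ha.trans_le har) hrb hp hslope

lemma exp_mul_dist_sq_add_slope_le_of_pos (hbot : ∀ x, E x ≠ ⊥) (hlsc : LowerSemicontinuous E)
    (h : IsIntegralEVIFlow E lam η) {a b p : ℝ} (ha : 0 < a) (hab : a ≤ b) (hp : 0 ≤ p)
    (hslope : ENNReal.ofReal p ≤ globalSlope E lam (η b)) {y : X} (hy : E y < ⊤) :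
    Real.exp (lam * (b - a)) / 2 * dist (η b) y ^ 2
      + (b - a) * expMean (lam * (b - a)) * ((E (η b)).toReal - (E y).toReal)
      + Real.exp (-(3 * |lam| * (b - a))) * p ^ 2 * (b - a) ^ 2 / 2 ≤ dist (η a) y ^ 2 / 2 := by
  set K := Real.exp (-(3 * |lam| * (b - a))) * p ^ 2
  have hbound : ∫ r in a..b, Real.exp (lam * (r - a)) * ((E y).toReal - (E (η r)).toReal) ≤
      ∫ r in a..b, (Real.exp (lam * (r - a)) * ((E y).toReal - (E (η b)).toReal)
        - K * (b - r)) := by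
    refine intervalIntegral.integral_mono_on hab ((intervalIntegrable_const.sub
      (h.intervalIntegrable hbot ha hab)).continuousOn_mul (by fun_prop))
      (Continuous.intervalIntegrable (by fun_prop) _ _) fun r ⟨har, hrb⟩ => ?_
    have hdissipation : K * (b - r) ≤ _ := h.le_exp_mul_dissipation hbot hlsc ha har hrb hp hslope
    linarith
  have hintegral : ∫ r in a..b, (Real.exp (lam * (r - a)) * ((E y).toReal - (E (η b)).toReal)
      - K * (b - r)) = (b - a) * expMean (lam * (b - a)) * ((E y).toReal - (E (η b)).toReal)
        - K * (b - a) ^ 2 / 2 := by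
    rw [intervalIntegral.integral_sub (Continuous.intervalIntegrable (by fun_prop) _ _)
      (Continuous.intervalIntegrable (by fun_prop) _ _), intervalIntegral.integral_mul_const,
      intervalIntegral.integral_const_mul, integral_exp_mul_sub,
      intervalIntegral.integral_comp_sub_left (fun r => r) b, integral_id]
    ring
  linarith [h.integral_evi y a b ha hab hy]

lemma exp_mul_dist_sq_add_slope_le (hbot : ∀ x, E x ≠ ⊥) (hlsc : LowerSemicontinuous E)
    (h : IsIntegralEVIFlow E lam η) {a b p : ℝ} (ha : 0 ≤ a) (hab : a ≤ b) (hp : 0 ≤ p)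
    (hslope : ENNReal.ofReal p ≤ globalSlope E lam (η b)) {y : X} (hy : E y < ⊤) :
    Real.exp (lam * (b - a)) / 2 * dist (η b) y ^ 2
      + (b - a) * expMean (lam * (b - a)) * ((E (η b)).toReal - (E y).toReal)
      + Real.exp (-(3 * |lam| * (b - a))) * p ^ 2 * (b - a) ^ 2 / 2 ≤ dist (η a) y ^ 2 / 2 := by
  rcases hab.eq_or_lt with rfl | hab
  · simp [div_eq_inv_mul]
  have hcont : Continuous fun r : ℝ => Real.exp (lam * (b - r)) / 2 * dist (η b) y ^ 2
      + (b - r) * expMean (lam * (b - r)) * ((E (η b)).toReal - (E y).toReal)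
      + Real.exp (-(3 * |lam| * (b - r))) * p ^ 2 * (b - r) ^ 2 / 2 := by fun_prop
  refine le_of_tendsto_of_tendsto ((hcont.tendsto a).mono_left nhdsWithin_le_nhds)
    ((((h.tendsto_nhdsGT ha).dist tendsto_const_nhds).pow 2).div_const 2) ?_
  filter_upwards [Ioo_mem_nhdsGT hab] with r hr
  exact h.exp_mul_dist_sq_add_slope_le_of_pos hbot hlsc (ha.trans_lt hr.1) hr.2.le hp hslope hy

end IsIntegralEVIFlow

lemma le_add_of_sq_le_sq_add_mul {x A B : ℝ} (hA : 0 ≤ A) (hB : 0 ≤ B)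
    (h : x ^ 2 ≤ A ^ 2 + B * x) : x ≤ A + B := by
  by_contra! hlt
  nlinarith

lemma le_ofReal_of_forall_ofReal_le {a : ℝ≥0∞} {c : ℝ}
    (h : ∀ p, 0 ≤ p → ENNReal.ofReal p ≤ a → p ≤ c) : a ≤ ENNReal.ofReal c := by
  refine ENNReal.le_of_forall_nnreal_lt fun r hr => ?_
  rw [← ENNReal.ofReal_coe_nnreal] at hr ⊢
  exact ENNReal.ofReal_le_ofReal (h r r.coe_nonneg hr.le)

namespace IsIntegralEVIFlow

variable {X : Type*} [MetricSpace X] {E : X → EReal} {lam : ℝ} {η ξ : ℝ → X}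

lemma dist_le_exp_mul_dist (hbot : ∀ x, E x ≠ ⊥) (hlsc : LowerSemicontinuous E)
    (hη : IsIntegralEVIFlow E lam η) (hξ : IsIntegralEVIFlow E lam ξ) {t : ℝ} (ht : 0 ≤ t) :
    dist (η t) (ξ t) ≤ Real.exp (-(lam * t)) * dist (η 0) (ξ 0) := by
  rw [Real.exp_neg, ← div_eq_inv_mul, le_div_iff₀' (Real.exp_pos _)]
  exact hη.exp_mul_dist_le hbot hlsc hξ ht

lemma dist_sq_add_energy_add_slope_le (hbot : ∀ x, E x ≠ ⊥) (hlsc : LowerSemicontinuous E)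
    (hη : IsIntegralEVIFlow E lam η) (hξ : IsIntegralEVIFlow E lam ξ) {a b p : ℝ} (ha : 0 ≤ a)
    (hab : a ≤ b) (hfin : E (η a) < ⊤) (hp : 0 ≤ p)
    (hslope : ENNReal.ofReal p ≤ globalSlope E lam (ξ b)) :
    Real.exp (lam * (b - a)) * dist (η a) (ξ b) ^ 2
      + 2 * expMean (lam * (b - a)) * (((E (ξ b)).toReal - (E (η a)).toReal) * (b - a))
      + Real.exp (-(3 * |lam| * (b - a))) * p ^ 2 * (b - a) ^ 2
      ≤ Real.exp (-(2 * lam * a)) * dist (η 0) (ξ 0) ^ 2 := by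
  have hbound := hξ.exp_mul_dist_sq_add_slope_le hbot hlsc ha hab hp hslope hfin
  have hcontraction := pow_le_pow_left₀ dist_nonneg (hη.dist_le_exp_mul_dist hbot hlsc hξ ha) 2
  rw [mul_pow, ← Real.exp_nat_mul] at hcontraction
  rw [show -(2 * lam * a) = (2 : ℕ) * -(lam * a) by push_cast; ring]
  rw [dist_comm (ξ b), dist_comm (ξ a)] at hbound
  linarith

end IsIntegralEVIFlow

/-- The curve `β` arises from `γ` by running, for every parameter `t ∈ s`, the flow issued from
`γ t` for the time `τ t`, and has finite energy. -/
structure IsFlowedCurve {X : Type*} [MetricSpace X] (E : X → EReal) (lam : ℝ) (s : Set ℝ)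
    (τ : ℝ → ℝ) (γ β : ℝ → X) : Prop where
  exists_flow : ∀ t ∈ s, ∃ η, IsIntegralEVIFlow E lam η ∧ η 0 = γ t ∧ η (τ t) = β t
  time_nonneg : ∀ t ∈ s, 0 ≤ τ t
  lt_top : ∀ t ∈ s, E (β t) < ⊤

namespace IsFlowedCurve

variable {X : Type*} [MetricSpace X] {E : X → EReal} {lam C : ℝ} {K : Set ℝ} {τ : ℝ → ℝ}
  {γ β : ℝ → X}

lemma mono (h : IsFlowedCurve E lam K τ γ β) {K' : Set ℝ} (hK : K' ⊆ K) :
    IsFlowedCurve E lam K' τ γ β :=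
  ⟨fun t ht => h.exists_flow t (hK ht), fun t ht => h.time_nonneg t (hK ht),
    fun t ht => h.lt_top t (hK ht)⟩

lemma continuousOn (hbot : ∀ x, E x ≠ ⊥) (hlsc : LowerSemicontinuous E)
    (h : IsFlowedCurve E lam K τ γ β) (hτ : ContinuousOn τ K) (hγ : ContinuousOn γ K) :
    ContinuousOn β K := by
  intro t ht
  obtain ⟨η, hη, hη₀, hηt⟩ := h.exists_flow t ht
  have htime : Tendsto (fun s => η (τ s)) (𝓝[K] t) (𝓝 (η (τ t))) :=
    (hη.continuousOn (τ t) (h.time_nonneg t ht)).tendsto.comp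
      (tendsto_nhdsWithin_iff.2 ⟨hτ t ht, eventually_nhdsWithin_of_forall h.time_nonneg⟩)
  have hlim := ((Real.continuous_exp.tendsto _).comp ((hτ t ht).tendsto.const_mul lam).neg).mul
    ((hγ t ht).tendsto.dist (tendsto_const_nhds (x := γ t)))
    |>.add (htime.dist (tendsto_const_nhds (x := η (τ t))))
  rw [dist_self, dist_self, mul_zero, add_zero] at hlim
  refine tendsto_iff_dist_tendsto_zero.2
    (squeeze_zero' (.of_forall fun _ => dist_nonneg) ?_ hlim)
  filter_upwards [self_mem_nhdsWithin] with s hs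
  obtain ⟨ξ, hξ, hξ₀, hξs⟩ := h.exists_flow s hs
  calc dist (β s) (β t) ≤ dist (ξ (τ s)) (η (τ s)) + dist (η (τ s)) (η (τ t)) := by
        rw [← hξs, ← hηt]
        exact dist_triangle _ _ _
    _ ≤ Real.exp (-(lam * τ s)) * dist (γ s) (γ t) + dist (η (τ s)) (η (τ t)) := by
        rw [← hξ₀, ← hη₀]
        gcongr
        exact hξ.dist_le_exp_mul_dist hbot hlsc hη (h.time_nonneg s hs)

lemma dist_sq_add_energy_add_slope_le (hbot : ∀ x, E x ≠ ⊥) (hlsc : LowerSemicontinuous E)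
    (h : IsFlowedCurve E lam K τ γ β) (hC : ∀ t ∈ K, Real.exp (-(2 * lam * τ t)) ≤ C)
    {s t p : ℝ} (hs : s ∈ K) (ht : t ∈ K) (hp : 0 ≤ p)
    (hslope_s : ENNReal.ofReal p ≤ globalSlope E lam (β s))
    (hslope_t : ENNReal.ofReal p ≤ globalSlope E lam (β t)) :
    Real.exp (lam * |τ s - τ t|) * dist (β s) (β t) ^ 2
      + 2 * expMean (lam * |τ s - τ t|) *
        (((E (β s)).toReal - (E (β t)).toReal) * (τ s - τ t))
      + Real.exp (-(3 * |lam| * |τ s - τ t|)) * p ^ 2 * (τ s - τ t) ^ 2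
      ≤ C * dist (γ s) (γ t) ^ 2 := by
  wlog hle : τ t ≤ τ s generalizing s t
  · have hswap := this ht hs hslope_t hslope_s (le_of_not_ge hle)
    rw [abs_sub_comm, dist_comm (β t), dist_comm (γ t)] at hswap
    linarith
  obtain ⟨ξ, hξ, hξ₀, hξs⟩ := h.exists_flow s hs
  obtain ⟨η, hη, hη₀, hηt⟩ := h.exists_flow t ht
  have hfin := h.lt_top t ht
  have hconst := mul_le_mul_of_nonneg_right (hC t ht) (sq_nonneg (dist (γ s) (γ t)))
  rw [← hξs] at hslope_s
  rw [← hηt] at hfin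
  have hmain := hη.dist_sq_add_energy_add_slope_le hbot hlsc hξ (h.time_nonneg t ht) hle
    hfin hp hslope_s
  rw [hξs, hηt, hξ₀, hη₀, dist_comm (β t), dist_comm (γ t)] at hmain
  rw [abs_of_nonneg (sub_nonneg.2 hle)]
  exact hmain.trans hconst

lemma energy_sub_mul_le (hbot : ∀ x, E x ≠ ⊥) (hlsc : LowerSemicontinuous E)
    (h : IsFlowedCurve E lam K τ γ β) {M : ℝ} (hM : ∀ t ∈ K, τ t ≤ M) {s t : ℝ} (hs : s ∈ K)
    (ht : t ∈ K) :
    ((E (β s)).toReal - (E (β t)).toReal) * (τ s - τ t) ≤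
      Real.exp (3 * |lam| * M) * dist (γ s) (γ t) ^ 2 := by
  set D := ((E (β s)).toReal - (E (β t)).toReal) * (τ s - τ t)
  rcases le_or_gt D 0 with hD | hD
  · exact hD.trans (by positivity)
  have hC : ∀ r ∈ K, Real.exp (-(2 * lam * τ r)) ≤ Real.exp (2 * |lam| * M) := fun r hr => by
    have hmul : |lam| * τ r ≤ |lam| * M := mul_le_mul_of_nonneg_left (hM r hr) (abs_nonneg _)
    have habs := mul_le_mul_of_nonneg_right (neg_abs_le lam) (h.time_nonneg r hr)
    exact Real.exp_le_exp.2 (by linarith)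
  have hmain := h.dist_sq_add_energy_add_slope_le hbot hlsc hC hs ht le_rfl (by simp) (by simp)
  have hgap : |τ s - τ t| ≤ M := abs_sub_le_of_nonneg_of_le (h.time_nonneg s hs) (hM s hs)
    (h.time_nonneg t ht) (hM t ht)
  have hexp : Real.exp (-(|lam| * M)) ≤ expMean (lam * |τ s - τ t|) := by
    refine le_trans (Real.exp_le_exp.2 (neg_le_neg ?_)) (exp_neg_abs_le_expMean _)
    rw [abs_mul, abs_abs]
    gcongr
  have hcoef := mul_le_mul_of_nonneg_right hexp hD.le
  have hsq : 0 ≤ Real.exp (lam * |τ s - τ t|) * dist (β s) (β t) ^ 2 := by positivity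
  have hD_le : Real.exp (-(|lam| * M)) * D ≤
      Real.exp (2 * |lam| * M) * dist (γ s) (γ t) ^ 2 := by
    have := (mul_pos (Real.exp_pos (-(|lam| * M))) hD).le
    linarith
  rw [Real.exp_neg, inv_mul_le_iff₀ (Real.exp_pos _), ← mul_assoc, ← Real.exp_add] at hD_le
  rwa [show 3 * |lam| * M = |lam| * M + 2 * |lam| * M by ring]

lemma exists_globalSlope_le (hbot : ∀ x, E x ≠ ⊥) (hlsc : LowerSemicontinuous E)
    (h : IsFlowedCurve E lam K τ γ β) (hK : IsCompact K) (hτ : ContinuousOn τ K)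
    (hγ : ContinuousOn γ K) (hτ_pos : ∀ t ∈ K, 0 < τ t) {y : X} (hy : E y < ⊤) :
    ∃ P, 0 ≤ P ∧ ∀ t ∈ K, globalSlope E lam (β t) ≤ ENNReal.ofReal P := by
  obtain ⟨L, hL⟩ := exists_real_le_of_isCompact hbot hlsc
    (hK.image_of_continuousOn (h.continuousOn hbot hlsc hτ hγ))
  set G : ℝ → ℝ := fun t =>
    (dist (γ t) y ^ 2 + 2 * τ t * expMean (lam * τ t) * ((E y).toReal - L)) /
      (Real.exp (-(3 * |lam| * τ t)) * τ t ^ 2)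
  have hG : ContinuousOn G K := by
    refine ContinuousOn.div ?_ (by fun_prop) fun t ht => ?_
    · have := continuous_expMean.comp_continuousOn (hτ.const_mul lam)
      simp only [Function.comp_def] at this
      fun_prop
    · have := hτ_pos t ht
      positivity
  obtain ⟨R, hR⟩ := hK.exists_bound_of_continuousOn hG
  refine ⟨√R, Real.sqrt_nonneg R, fun t ht => le_ofReal_of_forall_ofReal_le fun p hp hslope => ?_⟩
  refine Real.le_sqrt_of_sq_le (le_trans ?_ ((le_abs_self _).trans (hR t ht)))
  obtain ⟨η, hη, hη₀, hηt⟩ := h.exists_flow t ht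
  have hbound := hη.exp_mul_dist_sq_add_slope_le hbot hlsc le_rfl (h.time_nonneg t ht) hp
    (by rwa [hηt]) hy
  rw [hη₀, hηt, sub_zero] at hbound
  have hL_le : L ≤ (E (β t)).toReal := by
    have := hL (β t) (mem_image_of_mem β ht)
    rwa [← EReal.coe_toReal (h.lt_top t ht).ne (hbot _), EReal.coe_le_coe_iff] at this
  have hτt := hτ_pos t ht
  have henergy : τ t * expMean (lam * τ t) * (L - (E y).toReal) ≤
      τ t * expMean (lam * τ t) * ((E (β t)).toReal - (E y).toReal) := by
    have := (expMean_pos (lam * τ t)).le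
    gcongr
  have hsq : 0 ≤ Real.exp (lam * τ t) / 2 * dist (β t) y ^ 2 := by positivity
  rw [le_div_iff₀ (by positivity)]
  linarith

lemma exists_abs_energy_sub_le (hbot : ∀ x, E x ≠ ⊥) (hlsc : LowerSemicontinuous E)
    (h : IsFlowedCurve E lam K τ γ β) (hK : IsCompact K) (hτ : ContinuousOn τ K)
    (hγ : ContinuousOn γ K) (hτ_pos : ∀ t ∈ K, 0 < τ t) {y : X} (hy : E y < ⊤) :
    ∃ P, 0 ≤ P ∧ ∀ s ∈ K, ∀ t ∈ K,
      |(E (β s)).toReal - (E (β t)).toReal| ≤ P * dist (β s) (β t) := by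
  obtain ⟨P, hP, hslope⟩ := h.exists_globalSlope_le hbot hlsc hK hτ hγ hτ_pos hy
  have hbdd := (hK.image_of_continuousOn (h.continuousOn hbot hlsc hτ hγ)).isBounded
  set R := Metric.diam (β '' K)
  have : 0 ≤ R := Metric.diam_nonneg
  refine ⟨P + |lam| / 2 * R, by positivity, ?_⟩
  have hsub : ∀ s ∈ K, ∀ t ∈ K, (E (β s)).toReal - (E (β t)).toReal ≤
      (P + |lam| / 2 * R) * dist (β s) (β t) := by
    intro s hs t ht
    have hle := (globalSlope_le_ofReal_iff hP).1 (hslope s hs) (β t) (h.lt_top t ht)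
    have hdist : dist (β s) (β t) ≤ R := Metric.dist_le_diam_of_mem hbdd
      (mem_image_of_mem β hs) (mem_image_of_mem β ht)
    have hquad : -(|lam| / 2 * (R * dist (β s) (β t))) ≤ lam / 2 * dist (β s) (β t) ^ 2 := by
      have hsq : dist (β s) (β t) ^ 2 ≤ R * dist (β s) (β t) := by
        rw [sq]
        gcongr
      nlinarith [mul_le_mul_of_nonneg_left hsq (abs_nonneg lam), neg_abs_le lam,
        mul_le_mul_of_nonneg_right (neg_abs_le lam) (sq_nonneg (dist (β s) (β t)))]
    linarith
  refine fun s hs t ht => abs_sub_le_iff.2 ⟨hsub s hs t ht, ?_⟩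
  rw [dist_comm]
  exact hsub t ht s hs

lemma exists_dist_le (hbot : ∀ x, E x ≠ ⊥) (hlsc : LowerSemicontinuous E)
    (h : IsFlowedCurve E lam K τ γ β) (hK : IsCompact K) (hτ : ContinuousOn τ K)
    (hγ : ContinuousOn γ K) (hτ_pos : ∀ t ∈ K, 0 < τ t) {y : X} (hy : E y < ⊤) :
    ∃ A B, ∀ s ∈ K, ∀ t ∈ K, dist (β s) (β t) ≤ A * dist (γ s) (γ t) + B * dist (τ s) (τ t) := by
  obtain ⟨P, hP, henergy⟩ := h.exists_abs_energy_sub_le hbot hlsc hK hτ hγ hτ_pos hy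
  obtain ⟨M, hM⟩ := hK.exists_bound_of_continuousOn hτ
  obtain ⟨C, hC_abs⟩ := hK.exists_bound_of_continuousOn
    (f := fun t => Real.exp (-(2 * lam * τ t))) (by fun_prop)
  have hC := fun t ht => (le_abs_self _).trans (hC_abs t ht)
  set e := Real.exp (|lam| * M)
  refine ⟨√(e * C), 2 * e ^ 2 * P, fun s hs t ht => ?_⟩
  have hC_nonneg : 0 ≤ C := (Real.exp_pos _).le.trans (hC s hs)
  set r := |τ s - τ t|
  have hr : |lam * r| ≤ |lam| * M := by
    rw [abs_mul, abs_abs]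
    gcongr
    exact abs_sub_le_of_nonneg_of_le (h.time_nonneg s hs) ((le_abs_self _).trans (hM s hs))
      (h.time_nonneg t ht) ((le_abs_self _).trans (hM t ht))
  have hexp : e⁻¹ * dist (β s) (β t) ^ 2 ≤ Real.exp (lam * r) * dist (β s) (β t) ^ 2 := by
    rw [← Real.exp_neg]
    gcongr
    exact neg_le_of_abs_le hr
  have hcross : -(e * (P * dist (β s) (β t) * r)) ≤
      expMean (lam * r) * (((E (β s)).toReal - (E (β t)).toReal) * (τ s - τ t)) := by
    refine neg_le_of_abs_le ?_
    rw [abs_mul, abs_mul, abs_of_pos (expMean_pos _)]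
    gcongr
    · exact (expMean_le_exp_abs _).trans (Real.exp_le_exp.2 hr)
    · exact henergy s hs t ht
  have hmain := h.dist_sq_add_energy_add_slope_le hbot hlsc hC hs ht le_rfl (by simp) (by simp)
  have hdist_sq : e⁻¹ * dist (β s) (β t) ^ 2 ≤
      C * dist (γ s) (γ t) ^ 2 + 2 * e * (P * dist (β s) (β t) * r) := by linarith
  rw [inv_mul_le_iff₀ (Real.exp_pos _)] at hdist_sq
  refine le_add_of_sq_le_sq_add_mul (by positivity) (by positivity) ?_
  rw [mul_pow, Real.sq_sqrt (by positivity), Real.dist_eq]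
  linarith

lemma absolutelyContinuousOnInterval {a b : ℝ} (hab : a ≤ b) (hbot : ∀ x, E x ≠ ⊥)
    (hlsc : LowerSemicontinuous E) (h : IsFlowedCurve E lam (Icc a b) τ γ β)
    (hτ : AbsolutelyContinuousOnInterval τ a b) (hγ : AbsolutelyContinuousOnInterval γ a b)
    (hτ_pos : ∀ t ∈ Icc a b, 0 < τ t) :
    AbsolutelyContinuousOnInterval β a b ∧
      AbsolutelyContinuousOnInterval (fun t => (E (β t)).toReal) a b := by
  have hτ_cont := continuousOn_of_absolutelyContinuousOnInterval hab hτ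
  have hγ_cont := continuousOn_of_absolutelyContinuousOnInterval hab hγ
  have hy := h.lt_top a (left_mem_Icc.2 hab)
  obtain ⟨A, B, hdist⟩ := h.exists_dist_le hbot hlsc isCompact_Icc hτ_cont hγ_cont hτ_pos hy
  obtain ⟨P, -, henergy⟩ :=
    h.exists_abs_energy_sub_le hbot hlsc isCompact_Icc hτ_cont hγ_cont hτ_pos hy
  rw [← uIcc_of_le hab] at hdist henergy
  have hβ := absolutelyContinuousOnInterval_of_dist_le hγ hτ A B hdist
  refine ⟨hβ, absolutelyContinuousOnInterval_of_dist_le hβ hβ P 0 fun s hs t ht => ?_⟩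
  rw [zero_mul, add_zero]
  exact henergy s hs t ht

end IsFlowedCurve

lemma tendsto_toReal_min_of_lowerSemicontinuousAt {Y : Type*} [TopologicalSpace Y]
    {f : Y → ℝ≥0∞} {x : Y} {p : ℝ} (hf : LowerSemicontinuousAt f x) (hp : 0 ≤ p)
    (hle : ENNReal.ofReal p ≤ f x) :
    Tendsto (fun y => (min (ENNReal.ofReal p) (f y)).toReal) (𝓝 x) (𝓝 p) := by
  have hmin : Tendsto (fun y => min (ENNReal.ofReal p) (f y)) (𝓝 x) (𝓝 (ENNReal.ofReal p)) := by
    refine tendsto_order.2 ⟨fun c hc => ?_, fun c hc => .of_forall fun y =>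
      (min_le_left _ _).trans_lt hc⟩
    filter_upwards [hf c (hc.trans_le hle)] with y hy using lt_min hc hy
  have hlim := (ENNReal.tendsto_toReal ENNReal.ofReal_ne_top).comp hmin
  rwa [ENNReal.toReal_ofReal hp] at hlim

lemma add_ofReal_mul_sq_le_ofReal {a b : ℝ≥0∞} {c R : ℝ} (hc : 0 ≤ c)
    (h : ∀ p, 0 ≤ p → ENNReal.ofReal p ≤ b →
      0 ≤ R - c * p ^ 2 ∧ a ≤ ENNReal.ofReal (R - c * p ^ 2)) :
    0 ≤ R ∧ a + ENNReal.ofReal c * b ^ 2 ≤ ENNReal.ofReal R := by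
  refine ⟨by simpa using (h 0 le_rfl (by simp)).1, ?_⟩
  rcases hc.eq_or_lt with rfl | hc_pos
  · simpa using (h 0 le_rfl (by simp)).2
  have hb : b ≤ ENNReal.ofReal √(R / c) := by
    refine le_ofReal_of_forall_ofReal_le fun p hp hpb => Real.le_sqrt_of_sq_le ?_
    rw [le_div_iff₀' hc_pos]
    linarith [(h p hp hpb).1]
  have hb_top : b ≠ ⊤ := ne_top_of_le_ne_top ENNReal.ofReal_ne_top hb
  obtain ⟨hnonneg, ha⟩ := h b.toReal ENNReal.toReal_nonneg (ENNReal.ofReal_toReal hb_top).le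
  calc a + ENNReal.ofReal c * b ^ 2
      = a + ENNReal.ofReal (c * b.toReal ^ 2) := by
        rw [ENNReal.ofReal_mul hc, ENNReal.ofReal_pow ENNReal.toReal_nonneg,
          ENNReal.ofReal_toReal hb_top]
    _ ≤ ENNReal.ofReal (R - c * b.toReal ^ 2) + ENNReal.ofReal (c * b.toReal ^ 2) := by gcongr
    _ = ENNReal.ofReal R := by
        rw [← ENNReal.ofReal_add hnonneg (by positivity), sub_add_cancel]

namespace IsFlowedCurve

variable {X : Type*} [MetricSpace X] {E : X → EReal} {lam C : ℝ} {K : Set ℝ} {τ : ℝ → ℝ}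
  {γ β : ℝ → X}

lemma dist_sq_le_slope_mul_sq (hbot : ∀ x, E x ≠ ⊥) (hlsc : LowerSemicontinuous E)
    (h : IsFlowedCurve E lam K τ γ β) (hC : ∀ t ∈ K, Real.exp (-(2 * lam * τ t)) ≤ C)
    {s t m p : ℝ} (hs : s ∈ K) (ht : t ∈ K) (hst : s ≠ t) (hp : 0 ≤ p)
    (hslope_s : ENNReal.ofReal p ≤ globalSlope E lam (β s))
    (hslope_t : ENNReal.ofReal p ≤ globalSlope E lam (β t))
    (hm : dist (γ s) (γ t) ≤ m * |s - t|) :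
    dist (β s) (β t) ^ 2 ≤ Real.exp (-(lam * |τ s - τ t|)) * (C * m ^ 2
      - 2 * expMean (lam * |τ s - τ t|) * (slope (fun r => (E (β r)).toReal) t s * slope τ t s)
      - Real.exp (-(3 * |lam| * |τ s - τ t|)) * p ^ 2 * slope τ t s ^ 2) * (s - t) ^ 2 := by
  have hmain := h.dist_sq_add_energy_add_slope_le hbot hlsc hC hs ht hp hslope_s hslope_t
  have hγ : C * dist (γ s) (γ t) ^ 2 ≤ C * (m ^ 2 * (s - t) ^ 2) := by
    have hC_nonneg : 0 ≤ C := (Real.exp_pos _).le.trans (hC s hs)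
    have hsq := pow_le_pow_left₀ dist_nonneg hm 2
    rw [mul_pow, sq_abs] at hsq
    gcongr
  have hst : s - t ≠ 0 := sub_ne_zero.2 hst
  have hF : (E (β s)).toReal - (E (β t)).toReal =
      slope (fun r => (E (β r)).toReal) t s * (s - t) := by
    rw [slope_def_field, div_mul_cancel₀ _ hst]
  have hτ : τ s - τ t = slope τ t s * (s - t) := by
    rw [slope_def_field, div_mul_cancel₀ _ hst]
  rw [Real.exp_neg, mul_assoc, ← div_eq_inv_mul, le_div_iff₀' (Real.exp_pos _)]
  generalize |τ s - τ t| = r at hmain ⊢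
  rw [hF, hτ] at hmain
  linarith

lemma metricSpeed_sq_le_of_lt (hbot : ∀ x, E x ≠ ⊥) (hlsc : LowerSemicontinuous E)
    (h : IsFlowedCurve E lam K τ γ β) (hC : ∀ t ∈ K, Real.exp (-(2 * lam * τ t)) ≤ C) {t m p : ℝ}
    (hK : K ∈ 𝓝 t) (hβ : ContinuousAt β t) (hτ : DifferentiableAt ℝ τ t)
    (hF : DifferentiableAt ℝ (fun s => (E (β s)).toReal) t)
    (hm : metricSpeed γ t < ENNReal.ofReal m) (hp : 0 ≤ p)
    (hslope : ENNReal.ofReal p ≤ globalSlope E lam (β t)) :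
    0 ≤ C * m ^ 2 - 2 * (deriv (fun s => (E (β s)).toReal) t * deriv τ t) - deriv τ t ^ 2 * p ^ 2 ∧
      metricSpeed β t ^ 2 ≤ ENNReal.ofReal (C * m ^ 2
        - 2 * (deriv (fun s => (E (β s)).toReal) t * deriv τ t) - deriv τ t ^ 2 * p ^ 2) := by
  set F : ℝ → ℝ := fun s => (E (β s)).toReal
  set q : ℝ → ℝ := fun s => (min (ENNReal.ofReal p) (globalSlope E lam (β s))).toReal
  have hgap : Tendsto (fun s => |τ s - τ t|) (𝓝[≠] t) (𝓝 0) := by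
    have hlim := (hτ.continuousAt.tendsto.sub_const (τ t)).abs
    rw [sub_self, abs_zero] at hlim
    exact hlim.mono_left nhdsWithin_le_nhds
  have hq : Tendsto q (𝓝[≠] t) (𝓝 p) := (tendsto_toReal_min_of_lowerSemicontinuousAt
    (lowerSemicontinuousAt_globalSlope hβ hF.continuousAt) hp hslope).mono_left nhdsWithin_le_nhds
  have hF_slope := hasDerivAt_iff_tendsto_slope.1 hF.hasDerivAt
  have hτ_slope := hasDerivAt_iff_tendsto_slope.1 hτ.hasDerivAt
  have hφ := ((Real.continuous_exp.tendsto _).comp (hgap.const_mul lam).neg).mul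
    (((((continuous_expMean.tendsto _).comp (hgap.const_mul lam)).const_mul 2).mul
      (hF_slope.mul hτ_slope)).const_sub (C * m ^ 2) |>.sub
        ((((Real.continuous_exp.tendsto _).comp (hgap.const_mul (3 * |lam|)).neg).mul
          (hq.pow 2)).mul (hτ_slope.pow 2)))
  simp only [mul_zero, neg_zero, Real.exp_zero, expMean_zero, one_mul, mul_one] at hφ
  rw [mul_comm (deriv τ t ^ 2)]
  refine metricSpeed_sq_le_of_tendsto hφ ?_
  filter_upwards [eventually_dist_le_of_metricSpeed_lt hm, self_mem_nhdsWithin,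
    nhdsWithin_le_nhds hK] with s hs hst hsK
  have hq_eq : ENNReal.ofReal (q s) = min (ENNReal.ofReal p) (globalSlope E lam (β s)) :=
    ENNReal.ofReal_toReal (ne_top_of_le_ne_top ENNReal.ofReal_ne_top (min_le_left _ _))
  exact h.dist_sq_le_slope_mul_sq hbot hlsc hC hsK (mem_of_mem_nhds hK) hst ENNReal.toReal_nonneg
    (hq_eq.trans_le (min_le_right _ _)) (hq_eq.trans_le ((min_le_left _ _).trans hslope)) hs

lemma metricSpeed_sq_add_le (hbot : ∀ x, E x ≠ ⊥) (hlsc : LowerSemicontinuous E)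
    (h : IsFlowedCurve E lam K τ γ β) (hC : ∀ t ∈ K, Real.exp (-(2 * lam * τ t)) ≤ C) {t : ℝ}
    (hK : K ∈ 𝓝 t) (hβ : ContinuousAt β t) (hτ : DifferentiableAt ℝ τ t)
    (hF : DifferentiableAt ℝ (fun s => (E (β s)).toReal) t) (hγ : metricSpeed γ t ≠ ⊤) :
    0 ≤ C * (metricSpeed γ t ^ 2).toReal - 2 * (deriv (fun s => (E (β s)).toReal) t * deriv τ t) ∧
      metricSpeed β t ^ 2 + ENNReal.ofReal (deriv τ t ^ 2) * globalSlope E lam (β t) ^ 2 ≤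
        ENNReal.ofReal (C * (metricSpeed γ t ^ 2).toReal
          - 2 * (deriv (fun s => (E (β s)).toReal) t * deriv τ t)) := by
  rw [ENNReal.toReal_pow]
  set d := deriv (fun s => (E (β s)).toReal) t * deriv τ t
  refine add_ofReal_mul_sq_le_ofReal (sq_nonneg _) fun p hp hslope => ?_
  set v := (metricSpeed γ t).toReal
  have hlim : Tendsto (fun m => C * m ^ 2 - 2 * d - deriv τ t ^ 2 * p ^ 2) (𝓝[>] v)
      (𝓝 (C * v ^ 2 - 2 * d - deriv τ t ^ 2 * p ^ 2)) :=
    (Continuous.tendsto (by fun_prop) v).mono_left nhdsWithin_le_nhds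
  have hbound : ∀ᶠ m in 𝓝[>] v, 0 ≤ C * m ^ 2 - 2 * d - deriv τ t ^ 2 * p ^ 2 ∧
      metricSpeed β t ^ 2 ≤ ENNReal.ofReal (C * m ^ 2 - 2 * d - deriv τ t ^ 2 * p ^ 2) := by
    filter_upwards [self_mem_nhdsWithin] with m hm
    exact h.metricSpeed_sq_le_of_lt hbot hlsc hC hK hβ hτ hF
      ((ENNReal.lt_ofReal_iff_toReal_lt hγ).2 hm) hp hslope
  exact ⟨ge_of_tendsto hlim (hbound.mono fun m hm => hm.1),
    ge_of_tendsto (ENNReal.tendsto_ofReal hlim) (hbound.mono fun m hm => hm.2)⟩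

end IsFlowedCurve

lemma memLp_two_iff_lintegral_sq_ne_top {α : Type*} [MeasurableSpace α] {μ : Measure α}
    {f : α → ℝ≥0∞} : MemLp f 2 μ ↔ AEMeasurable f μ ∧ ∫⁻ x, f x ^ 2 ∂μ ≠ ⊤ := by
  rw [MemLp, aestronglyMeasurable_iff_aemeasurable,
    eLpNorm_lt_top_iff_lintegral_rpow_enorm_lt_top two_ne_zero ENNReal.ofNat_ne_top,
    lt_top_iff_ne_top]
  simp only [enorm_eq_self, ENNReal.toReal_ofNat, ENNReal.rpow_two]

lemma intervalIntegrable_deriv_of_sub_le_integral {F g : ℝ → ℝ} {a b : ℝ} (hab : a ≤ b)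
    (hg : IntervalIntegrable g volume a b)
    (h : ∀ s t, a ≤ s → s ≤ t → t ≤ b → F t - F s ≤ ∫ r in s..t, g r) :
    IntervalIntegrable (deriv F) volume a b := by
  set G : ℝ → ℝ := fun t => (∫ r in a..t, g r) - F t
  have hsub : ∀ t ∈ Icc a b, IntervalIntegrable g volume a t := fun t ht =>
    hg.mono_set (by rw [uIcc_of_le ht.1, uIcc_of_le hab]; exact Icc_subset_Icc_right ht.2)
  have hG : MonotoneOn G (uIcc a b) := by
    rw [uIcc_of_le hab]
    intro s hs t ht hst
    have hle := h s t hs.1 hst ht.2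
    rw [← intervalIntegral.integral_interval_sub_left (hsub t ht) (hsub s hs)] at hle
    simp only [G]
    linarith
  refine (hg.sub hG.intervalIntegrable_deriv).congr_ae ?_
  rw [uIoc_of_le hab, ← restrict_Ioo_eq_restrict_Ioc]
  refine (ae_restrict_iff' measurableSet_Ioo).2 ?_
  filter_upwards [hg.ae_hasDerivAt_integral, hG.ae_differentiableWithinAt_of_mem]
    with t hprim hdiff ht
  rw [uIcc_of_le hab] at hprim hdiff
  have htmem := Ioo_subset_Icc_self ht
  have hGt := ((hdiff htmem).differentiableAt (Icc_mem_nhds ht.1 ht.2)).hasDerivAt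
  have hFt := (hprim htmem a (left_mem_Icc.2 hab)).sub hGt
  rw [← hFt.deriv]
  congr 1
  ext r
  exact sub_sub_cancel _ _

lemma lowerSemicontinuous_toENNReal_sub {X : Type*} [TopologicalSpace X] {E : X → EReal}
    (hlsc : LowerSemicontinuous E) {c : EReal} (hc : c ≠ ⊥) :
    LowerSemicontinuous fun x => (E x - c).toENNReal := by
  induction c with
  | bot => exact absurd rfl hc
  | top =>
    simp only [EReal.sub_top, EReal.toENNReal_bot]
    exact lowerSemicontinuous_const
  | coe c =>
    refine Continuous.comp_lowerSemicontinuous (g := fun z : EReal => (z - c).toENNReal)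
      (EReal.continuous_toENNReal.comp (continuous_iff_continuousAt.2 fun z => ?_)) hlsc
      fun z w hzw => EReal.toENNReal_le_toENNReal (EReal.sub_le_sub hzw le_rfl)
    exact (EReal.continuousAt_add (p := (z, -(c : EReal))) (.inr (by simp)) (.inr (by simp))).comp
      (f := fun w : EReal => (w, -(c : EReal))) (continuousAt_id.prodMk continuousAt_const)

lemma aemeasurable_metricSlope_comp {X : Type*} [MetricSpace X] {E : X → EReal} {β : ℝ → X}
    {a b : ℝ} (hbot : ∀ x, E x ≠ ⊥) (hlsc : LowerSemicontinuous E) (hab : a ≤ b)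
    (hβ : ContinuousOn β (Icc a b)) (hfin : ∀ t ∈ Icc a b, E (β t) < ⊤) :
    AEMeasurable (fun t => metricSlope E (β t)) (volume.restrict (Ioo a b)) := by
  borelize X
  have hmeas := measurable_limsup_div_edist fun y =>
    lowerSemicontinuous_toENNReal_sub hlsc (hbot y)
  refine ⟨_, hmeas.comp (hβ.domRestrict.Icc_extend' (h := hab)).measurable, ?_⟩
  filter_upwards [ae_restrict_mem measurableSet_Ioo] with t ht
  rw [Function.comp_apply, IccExtend_of_mem hab _ (Ioo_subset_Icc_self ht), domRestrict_apply]
  exact if_pos (hfin t (Ioo_subset_Icc_self ht))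

lemma lintegral_ne_top_of_lintegral_sq_ne_top {α : Type*} [MeasurableSpace α] {μ : Measure α}
    [IsFiniteMeasure μ] {f : α → ℝ≥0∞} (hf : AEMeasurable f μ) (hfin : ∫⁻ x, f x ^ 2 ∂μ ≠ ⊤) :
    ∫⁻ x, f x ∂μ ≠ ⊤ := by
  have hLp := (memLp_two_iff_lintegral_sq_ne_top.2 ⟨hf, hfin⟩).mono_exponent one_le_two
  simpa only [HasFiniteIntegral, enorm_eq_self, lt_top_iff_ne_top] using
    (memLp_one_iff_integrable.1 hLp).hasFiniteIntegral

namespace IsAC2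

variable {X : Type*} [MetricSpace X] {γ : ℝ → X}

lemma lintegral_metricSpeed_sq_ne_top (hγ : IsAC2 γ) :
    ∫⁻ r in Ioo (0 : ℝ) 1, metricSpeed γ r ^ 2 ≠ ⊤ :=
  (memLp_two_iff_lintegral_sq_ne_top.1 hγ.2).2

lemma intervalIntegrable_metricSpeed_sq (hγ : IsAC2 γ) :
    IntervalIntegrable (fun r => (metricSpeed γ r ^ 2).toReal) volume 0 1 := by
  rw [intervalIntegrable_iff_integrableOn_Ioo_of_le zero_le_one]
  exact integrable_toReal_of_lintegral_ne_top (hγ.2.aestronglyMeasurable.aemeasurable.pow_const 2)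
    hγ.lintegral_metricSpeed_sq_ne_top

lemma continuousOn (hγ : IsAC2 γ) : ContinuousOn γ (Icc 0 1) :=
  continuousOn_of_absolutelyContinuousOnInterval zero_le_one hγ.1

lemma dist_sq_le (hγ : IsAC2 γ) {s t : ℝ} (hs : 0 ≤ s) (hst : s ≤ t) (ht : t ≤ 1) :
    dist (γ s) (γ t) ^ 2 ≤ (t - s) * ∫ r in s..t, (metricSpeed γ r ^ 2).toReal :=
  dist_sq_le_integral_metricSpeed_sq hst
    (hγ.1.mono (by
      rw [uIcc_of_le hst, uIcc_of_le zero_le_one]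
      exact Icc_subset_Icc hs ht))
    (ne_top_of_le_ne_top hγ.lintegral_metricSpeed_sq_ne_top
      (lintegral_mono_set (Ioo_subset_Ioo hs ht)))

lemma dist_sq_le_abs (hγ : IsAC2 γ) {s t : ℝ} (hs : s ∈ Icc (0 : ℝ) 1) (ht : t ∈ Icc (0 : ℝ) 1) :
    dist (γ s) (γ t) ^ 2 ≤ |s - t| * |∫ r in t..s, (metricSpeed γ r ^ 2).toReal| := by
  rcases le_total t s with hts | hst
  · rw [dist_comm, abs_of_nonneg (sub_nonneg.2 hts)]
    exact (hγ.dist_sq_le ht.1 hts hs.2).trans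
      (mul_le_mul_of_nonneg_left (le_abs_self _) (sub_nonneg.2 hts))
  · rw [abs_sub_comm, abs_of_nonneg (sub_nonneg.2 hst), intervalIntegral.integral_symm, abs_neg]
    exact (hγ.dist_sq_le hs.1 hst ht.2).trans
      (mul_le_mul_of_nonneg_left (le_abs_self _) (sub_nonneg.2 hst))

lemma of_locally (hcont : ContinuousOn γ (Icc 0 1))
    (hloc : ∀ s t, 0 < s → s ≤ t → t < 1 → AbsolutelyContinuousOnInterval γ s t)
    (hfin : ∫⁻ r in Ioo (0 : ℝ) 1, metricSpeed γ r ^ 2 ≠ ⊤) : IsAC2 γ := by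
  have hmeas := aemeasurable_metricSpeed zero_le_one hcont
  have hfin_one := lintegral_ne_top_of_lintegral_sq_ne_top hmeas hfin
  have hspeed : IntervalIntegrable (fun r => (metricSpeed γ r).toReal) volume 0 1 := by
    rw [intervalIntegrable_iff_integrableOn_Ioo_of_le zero_le_one]
    exact integrable_toReal_of_lintegral_ne_top hmeas hfin_one
  refine ⟨absolutelyContinuousOnInterval_of_dist_le_integral zero_le_one hcont hspeed
    fun s t hs hst ht => dist_le_integral_metricSpeed hst (hloc s t hs hst ht) ?_,
    memLp_two_iff_lintegral_sq_ne_top.2 ⟨hmeas, hfin⟩⟩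
  exact ne_top_of_le_ne_top hfin_one (lintegral_mono_set (Ioo_subset_Ioo hs.le ht.le))

end IsAC2

/-- The time `ε min(t, 1 - t)` for which the flow is run at the parameter `t` of the regularized
curve. -/
def regularizationTime (ε t : ℝ) : ℝ := ε * min t (1 - t)

namespace regularizationTime

variable {ε : ℝ}

lemma eq_of_le_half {t : ℝ} (ht : t ≤ 1 / 2) : regularizationTime ε t = ε * t := by
  rw [regularizationTime, min_eq_left (by linarith)]

lemma eq_of_half_le {t : ℝ} (ht : 1 / 2 ≤ t) : regularizationTime ε t = ε * (1 - t) := by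
  rw [regularizationTime, min_eq_right (by linarith)]

lemma nonneg (hε : 0 < ε) {t : ℝ} (ht : t ∈ Icc (0 : ℝ) 1) : 0 ≤ regularizationTime ε t :=
  mul_nonneg hε.le (le_min ht.1 (sub_nonneg.2 ht.2))

lemma pos (hε : 0 < ε) {t : ℝ} (ht : t ∈ Ioo (0 : ℝ) 1) : 0 < regularizationTime ε t :=
  mul_pos hε (lt_min ht.1 (sub_pos.2 ht.2))

lemma le_half (hε : 0 < ε) (t : ℝ) : regularizationTime ε t ≤ ε / 2 := by
  have hmin : min t (1 - t) ≤ 1 / 2 := by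
    rcases le_total t (1 / 2) with ht | ht
    · exact min_le_of_left_le ht
    · exact min_le_of_right_le (by linarith)
  rw [regularizationTime, div_eq_mul_one_div]
  gcongr

lemma lipschitzWith : LipschitzWith (‖ε‖₊ * max 1 1) (regularizationTime ε) :=
  (lipschitzWith_smul ε).comp (LipschitzWith.id.min (LipschitzWith.of_dist_le_mul fun s t => by
    rw [dist_sub_left, NNReal.coe_one, one_mul]))

lemma hasDerivAt_of_lt_half {t : ℝ} (ht : t < 1 / 2) :
    HasDerivAt (regularizationTime ε) ε t := by
  have hlin := (hasDerivAt_id t).const_mul ε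
  rw [mul_one] at hlin
  exact hlin.congr_of_eventuallyEq
    ((gt_mem_nhds ht).mono fun s hs => eq_of_le_half (le_of_lt hs))

lemma hasDerivAt_of_half_lt {t : ℝ} (ht : 1 / 2 < t) :
    HasDerivAt (regularizationTime ε) (-ε) t := by
  have hlin := ((hasDerivAt_id t).const_sub 1).const_mul ε
  rw [mul_neg_one] at hlin
  exact hlin.congr_of_eventuallyEq
    ((lt_mem_nhds ht).mono fun s hs => eq_of_half_le (le_of_lt hs))

lemma hasIntegral_mul_deriv {f : ℝ → ℝ} (hf : IntervalIntegrable f volume 0 1) :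
    IntervalIntegrable (fun t => f t * deriv (regularizationTime ε) t) volume 0 1 ∧
      ∫ t in (0 : ℝ)..1, f t * deriv (regularizationTime ε) t =
        ε * ((∫ t in (0 : ℝ)..(1 / 2), f t) - ∫ t in (1 / 2 : ℝ)..1, f t) := by
  have hleft : EqOn (fun t => f t * ε) (fun t => f t * deriv (regularizationTime ε) t)
      (uIoo 0 (1 / 2)) := fun t ht => by
    rw [uIoo_of_le (by norm_num)] at ht
    simp only [(hasDerivAt_of_lt_half ht.2).deriv]
  have hright : EqOn (fun t => f t * -ε) (fun t => f t * deriv (regularizationTime ε) t)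
      (uIoo (1 / 2) 1) := fun t ht => by
    rw [uIoo_of_le (by norm_num)] at ht
    simp only [(hasDerivAt_of_half_lt ht.1).deriv]
  have hhalf : (1 / 2 : ℝ) ∈ uIcc 0 1 := by
    rw [uIcc_of_le zero_le_one]
    norm_num
  have hint_left := ((hf.mono_set (uIcc_subset_uIcc left_mem_uIcc hhalf)).mul_const ε).congr_uIoo
    hleft
  have hint_right :=
    ((hf.mono_set (uIcc_subset_uIcc hhalf right_mem_uIcc)).mul_const (-ε)).congr_uIoo hright
  refine ⟨hint_left.trans hint_right, ?_⟩
  rw [← intervalIntegral.integral_add_adjacent_intervals hint_left hint_right,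
    ← intervalIntegral.integral_congr_uIoo hleft, ← intervalIntegral.integral_congr_uIoo hright,
    intervalIntegral.integral_mul_const, intervalIntegral.integral_mul_const]
  ring

end regularizationTime

namespace IsFlowedCurve

variable {X : Type*} [MetricSpace X] {E : X → EReal} {lam : ℝ} {τ : ℝ → ℝ} {γ β : ℝ → X}

lemma continuousWithinAt_energy (hbot : ∀ x, E x ≠ ⊥) (hlsc : LowerSemicontinuous E) {K : Set ℝ}
    {M : ℝ} (h : IsFlowedCurve E lam K τ γ β) (hM : ∀ t ∈ K, τ t ≤ M) (hτ : ContinuousOn τ K)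
    (hγ : ContinuousOn γ K) {t : ℝ} (ht : t ∈ K) (hτt : τ t = 0)
    (hτ_pos : ∀ᶠ s in 𝓝[K] t, s ≠ t → 0 < τ s)
    (hquot : Tendsto (fun s => dist (γ s) (γ t) ^ 2 / τ s) (𝓝[K] t) (𝓝 0)) :
    ContinuousWithinAt (fun s => (E (β s)).toReal) K t := by
  have hupper := (hquot.const_mul (Real.exp (3 * |lam| * M))).const_add (E (β t)).toReal
  rw [mul_zero, add_zero] at hupper
  refine tendsto_toReal_of_lowerSemicontinuous_of_le hbot hlsc (h.continuousOn hbot hlsc hτ hγ t ht)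
    (h.lt_top t ht) (eventually_nhdsWithin_of_forall h.lt_top) hupper ?_
  filter_upwards [hτ_pos, self_mem_nhdsWithin] with s hs_pos hs
  rcases eq_or_ne s t with rfl | hst
  · rw [dist_self, zero_pow two_ne_zero, zero_div, mul_zero, add_zero]
  have hle := h.energy_sub_mul_le hbot hlsc hM hs ht
  rw [hτt, sub_zero, ← le_div_iff₀ (hs_pos hst), mul_div_assoc] at hle
  linarith

lemma intervalIntegrable_deriv_energy (hbot : ∀ x, E x ≠ ⊥) (hlsc : LowerSemicontinuous E)
    (hγ : IsAC2 γ) {a b c M : ℝ} (ha : 0 ≤ a) (hab : a ≤ b) (hb : b ≤ 1)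
    (h : IsFlowedCurve E lam (Icc a b) τ γ β) (hM : ∀ t ∈ Icc a b, τ t ≤ M) (hc : c ≠ 0)
    (hτ : ∀ s ∈ Icc a b, ∀ t ∈ Icc a b, τ t - τ s = c * (t - s)) :
    IntervalIntegrable (deriv fun t => (E (β t)).toReal) volume a b := by
  set F : ℝ → ℝ := fun t => (E (β t)).toReal
  have hsub : uIcc a b ⊆ uIcc 0 1 := by
    rw [uIcc_of_le hab, uIcc_of_le zero_le_one]
    exact Icc_subset_Icc ha hb
  have hg := (hγ.intervalIntegrable_metricSpeed_sq.mono_set hsub).const_mul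
    (Real.exp (3 * |lam| * M))
  have hderiv := intervalIntegrable_deriv_of_sub_le_integral (F := fun t => c * F t) hab hg
    fun s t hs hst ht => ?_
  · rw [deriv_const_mul_field'] at hderiv
    simpa only [inv_mul_cancel_left₀ hc] using hderiv.const_mul c⁻¹
  rcases hst.eq_or_lt with rfl | hst
  · simp only [sub_self, intervalIntegral.integral_same, le_refl]
  have hs_mem : s ∈ Icc a b := ⟨hs, hst.le.trans ht⟩
  have ht_mem : t ∈ Icc a b := ⟨hs.trans hst.le, ht⟩
  have henergy := h.energy_sub_mul_le hbot hlsc hM ht_mem hs_mem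
  rw [hτ s hs_mem t ht_mem, dist_comm] at henergy
  have hdist := mul_le_mul_of_nonneg_left
    (hγ.dist_sq_le (ha.trans hs) hst.le (ht.trans hb)) (Real.exp_pos (3 * |lam| * M)).le
  rw [intervalIntegral.integral_const_mul]
  refine le_of_mul_le_mul_right (a := t - s) ?_ (sub_pos.2 hst)
  linarith

end IsFlowedCurve

namespace regularizationTime

lemma eventually_eq_mul_abs_sub (ε : ℝ) {t : ℝ} (ht : t = 0 ∨ t = 1) :
    ∀ᶠ s in 𝓝[Icc 0 1] t, regularizationTime ε s = ε * |s - t| := by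
  filter_upwards [self_mem_nhdsWithin,
    nhdsWithin_le_nhds (Metric.ball_mem_nhds t one_half_pos)] with s hs hst
  rw [Metric.mem_ball, Real.dist_eq, abs_lt] at hst
  rcases ht with rfl | rfl
  · rw [sub_zero, abs_of_nonneg hs.1, eq_of_le_half (by linarith)]
  · rw [abs_sub_comm, abs_of_nonneg (sub_nonneg.2 hs.2), eq_of_half_le (by linarith)]

lemma tendsto_dist_sq_div {X : Type*} [MetricSpace X] {γ : ℝ → X} (hγ : IsAC2 γ) {ε : ℝ}
    (hε : 0 < ε) {t : ℝ} (ht : t = 0 ∨ t = 1) :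
    Tendsto (fun s => dist (γ s) (γ t) ^ 2 / regularizationTime ε s) (𝓝[Icc 0 1] t) (𝓝 0) := by
  have htmem : t ∈ Icc (0 : ℝ) 1 := by rcases ht with rfl | rfl <;> norm_num
  have hprim := intervalIntegral.continuousOn_primitive_interval'
    hγ.intervalIntegrable_metricSpeed_sq (by rwa [uIcc_of_le zero_le_one])
  rw [uIcc_of_le zero_le_one] at hprim
  have hbound := (hprim t htmem).tendsto.abs.div_const ε
  rw [intervalIntegral.integral_same, abs_zero, zero_div] at hbound
  refine squeeze_zero' ?_ ?_ hbound
  · filter_upwards [self_mem_nhdsWithin] with s hs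
    exact div_nonneg (sq_nonneg _) (nonneg hε hs)
  · filter_upwards [self_mem_nhdsWithin, eventually_eq_mul_abs_sub ε ht] with s hs hτ
    rcases eq_or_ne s t with rfl | hst
    · simp only [dist_self, ne_eq, OfNat.ofNat_ne_zero, not_false_eq_true, zero_pow, zero_div]
      positivity
    have hgap : 0 < |s - t| := abs_pos.2 (sub_ne_zero.2 hst)
    rw [hτ, div_le_div_iff₀ (mul_pos hε hgap) hε]
    nlinarith [mul_le_mul_of_nonneg_left (hγ.dist_sq_le_abs hs htmem) hε.le]

end regularizationTime

namespace IsFlowedCurve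

variable {X : Type*} [MetricSpace X] {E : X → EReal} {lam ε : ℝ} {γ β : ℝ → X}

section Regularization

variable (hbot : ∀ x, E x ≠ ⊥) (hlsc : LowerSemicontinuous E) (hε : 0 < ε) (hγ : IsAC2 γ)
  (h : IsFlowedCurve E lam (Icc 0 1) (regularizationTime ε) γ β)

include hbot hlsc hγ h

lemma continuousOn_of_isAC2 : ContinuousOn β (Icc 0 1) :=
  h.continuousOn hbot hlsc regularizationTime.lipschitzWith.continuous.continuousOn hγ.continuousOn

include hε

lemma absolutelyContinuousOnInterval_of_mem_Ioo {s t : ℝ} (hs : 0 < s) (hst : s ≤ t) (ht : t < 1) :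
    AbsolutelyContinuousOnInterval β s t ∧
      AbsolutelyContinuousOnInterval (fun r => (E (β r)).toReal) s t := by
  have hsub : Icc s t ⊆ Icc 0 1 := Icc_subset_Icc hs.le ht.le
  have hτ : LipschitzOnWith _ (regularizationTime ε) (uIcc s t) :=
    regularizationTime.lipschitzWith.lipschitzOnWith
  exact (h.mono hsub).absolutelyContinuousOnInterval hst hbot hlsc
    hτ.absolutelyContinuousOnInterval
    (hγ.1.mono (by rwa [uIcc_of_le hst, uIcc_of_le zero_le_one]))
    fun r hr => regularizationTime.pos hε ⟨hs.trans_le hr.1, hr.2.trans_lt ht⟩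

lemma continuousOn_energy : ContinuousOn (fun t => (E (β t)).toReal) (Icc 0 1) := by
  have hendpoint : ∀ t : ℝ, t = 0 ∨ t = 1 →
      ContinuousWithinAt (fun t => (E (β t)).toReal) (Icc 0 1) t := by
    intro t ht
    have htmem : t ∈ Icc (0 : ℝ) 1 := by rcases ht with rfl | rfl <;> norm_num
    have hτ := regularizationTime.eventually_eq_mul_abs_sub ε ht
    refine h.continuousWithinAt_energy hbot hlsc (fun s _ => regularizationTime.le_half hε s)
      regularizationTime.lipschitzWith.continuous.continuousOn hγ.continuousOn htmem
      (by rw [hτ.self_of_nhdsWithin htmem, sub_self, abs_zero, mul_zero]) ?_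
      (regularizationTime.tendsto_dist_sq_div hγ hε ht)
    filter_upwards [hτ] with s hs hst
    rw [hs]
    exact mul_pos hε (abs_pos.2 (sub_ne_zero.2 hst))
  intro t ht
  rcases ht.1.eq_or_lt with rfl | ht_pos
  · exact hendpoint 0 (.inl rfl)
  rcases ht.2.eq_or_lt with rfl | ht_lt
  · exact hendpoint 1 (.inr rfl)
  have hle : t / 2 ≤ (1 + t) / 2 := by linarith
  have hac := (h.absolutelyContinuousOnInterval_of_mem_Ioo hbot hlsc hε hγ (half_pos ht_pos) hle
    (by linarith)).2
  have hcont := continuousOn_of_absolutelyContinuousOnInterval hle hac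
  exact (hcont.continuousAt (Icc_mem_nhds (by linarith) (by linarith))).continuousWithinAt

lemma intervalIntegrable_deriv_energy_of_isAC2 :
    IntervalIntegrable (deriv fun t => (E (β t)).toReal) volume 0 1 := by
  refine IntervalIntegrable.trans (b := 1 / 2) ?_ ?_
  · refine (h.mono (Icc_subset_Icc_right (by norm_num))).intervalIntegrable_deriv_energy hbot hlsc
      hγ le_rfl (by norm_num) (by norm_num) (fun t _ => regularizationTime.le_half hε t) hε.ne'
      fun s hs t ht => ?_
    rw [regularizationTime.eq_of_le_half hs.2, regularizationTime.eq_of_le_half ht.2]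
    ring
  · refine (h.mono (Icc_subset_Icc_left (by norm_num))).intervalIntegrable_deriv_energy hbot hlsc
      hγ (by norm_num) (by norm_num) le_rfl (fun t _ => regularizationTime.le_half hε t)
      (neg_ne_zero.2 hε.ne') fun s hs t ht => ?_
    rw [regularizationTime.eq_of_half_le hs.1, regularizationTime.eq_of_half_le ht.1]
    ring

lemma absolutelyContinuousOnInterval_energy :
    AbsolutelyContinuousOnInterval (fun t => (E (β t)).toReal) 0 1 := by
  refine absolutelyContinuousOnInterval_of_dist_le_integral zero_le_one
    (h.continuousOn_energy hbot hlsc hε hγ)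
    (h.intervalIntegrable_deriv_energy_of_isAC2 hbot hlsc hε hγ).norm fun s t hs hst ht => ?_
  have hac := (h.absolutelyContinuousOnInterval_of_mem_Ioo hbot hlsc hε hγ hs hst ht).2
  rw [dist_comm, dist_eq_norm, ← hac.integral_deriv_eq_sub]
  exact intervalIntegral.norm_integral_le_integral_norm hst

lemma ae_metricSpeed_sq_add_le : ∀ᵐ t ∂volume.restrict (Ioo (0 : ℝ) 1),
    0 ≤ Real.exp (max (-lam) 0 * ε) * (metricSpeed γ t ^ 2).toReal
        - 2 * (deriv (fun s => (E (β s)).toReal) t * deriv (regularizationTime ε) t) ∧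
      metricSpeed β t ^ 2 + ENNReal.ofReal (ε ^ 2) * globalSlope E lam (β t) ^ 2 ≤
        ENNReal.ofReal (Real.exp (max (-lam) 0 * ε) * (metricSpeed γ t ^ 2).toReal
          - 2 * (deriv (fun s => (E (β s)).toReal) t * deriv (regularizationTime ε) t)) := by
  have hC : ∀ t ∈ Icc (0 : ℝ) 1,
      Real.exp (-(2 * lam * regularizationTime ε t)) ≤ Real.exp (max (-lam) 0 * ε) := by
    intro t ht
    have hτ := regularizationTime.le_half hε t
    have hneg := mul_le_mul_of_nonneg_right (le_max_left (-lam) 0)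
      (regularizationTime.nonneg hε ht)
    have hmul := mul_le_mul_of_nonneg_left hτ (le_max_right (-lam) 0)
    exact Real.exp_le_exp.2 (by linarith)
  have hF := h.absolutelyContinuousOnInterval_energy hbot hlsc hε hγ
  have hfin := ae_lt_top' (hγ.2.aestronglyMeasurable.aemeasurable.pow_const 2)
    hγ.lintegral_metricSpeed_sq_ne_top
  filter_upwards [ae_restrict_mem measurableSet_Ioo, ae_restrict_of_ae hF.ae_differentiableAt, hfin,
    ae_restrict_of_ae (Measure.ae_ne volume (1 / 2 : ℝ))] with t ht hdiff hspeed hhalf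
  have htmem := Ioo_subset_Icc_self ht
  obtain ⟨c, hτ, hc⟩ : ∃ c, HasDerivAt (regularizationTime ε) c t ∧ c ^ 2 = ε ^ 2 := by
    rcases hhalf.lt_or_gt with hlt | hgt
    · exact ⟨ε, regularizationTime.hasDerivAt_of_lt_half hlt, rfl⟩
    · exact ⟨-ε, regularizationTime.hasDerivAt_of_half_lt hgt, neg_sq ε⟩
  have hnhds := Icc_mem_nhds ht.1 ht.2
  rw [← hc, ← hτ.deriv]
  exact h.metricSpeed_sq_add_le hbot hlsc hC hnhds
    ((h.continuousOn_of_isAC2 hbot hlsc hγ).continuousAt hnhds) hτ.differentiableAt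
    (hdiff (by rwa [uIcc_of_le zero_le_one]))
    (ne_top_of_lt (lt_of_le_of_ne le_top fun htop => by simp [htop] at hspeed))

lemma lintegral_metricSpeed_sq_add_le :
    0 ≤ Real.exp (max (-lam) 0 * ε) * (∫⁻ t in Ioo (0 : ℝ) 1, metricSpeed γ t ^ 2).toReal
        - 2 * ε * (2 * (E (β (1 / 2))).toReal - (E (β 0)).toReal - (E (β 1)).toReal) ∧
    ∫⁻ t in Ioo (0 : ℝ) 1,
        (metricSpeed β t ^ 2 + ENNReal.ofReal (ε ^ 2) * globalSlope E lam (β t) ^ 2) ≤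
      ENNReal.ofReal (
        Real.exp (max (-lam) 0 * ε) * (∫⁻ t in Ioo (0 : ℝ) 1, metricSpeed γ t ^ 2).toReal
          - 2 * ε * (2 * (E (β (1 / 2))).toReal - (E (β 0)).toReal - (E (β 1)).toReal)) := by
  set F : ℝ → ℝ := fun t => (E (β t)).toReal
  set C := Real.exp (max (-lam) 0 * ε)
  have hae := h.ae_metricSpeed_sq_add_le hbot hlsc hε hγ
  have hF := h.absolutelyContinuousOnInterval_energy hbot hlsc hε hγ
  have hhalf : (1 / 2 : ℝ) ∈ uIcc 0 1 := by
    rw [uIcc_of_le zero_le_one]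
    norm_num
  obtain ⟨hint, hint_eq⟩ := regularizationTime.hasIntegral_mul_deriv (ε := ε)
    (h.intervalIntegrable_deriv_energy_of_isAC2 hbot hlsc hε hγ)
  rw [(hF.mono (uIcc_subset_uIcc left_mem_uIcc hhalf)).integral_deriv_eq_sub,
    (hF.mono (uIcc_subset_uIcc hhalf right_mem_uIcc)).integral_deriv_eq_sub] at hint_eq
  have hspeed := hγ.intervalIntegrable_metricSpeed_sq.const_mul C
  have hspeed_eq := integral_toReal_eq_toReal_lintegral_Ioo zero_le_one
    (hγ.2.aestronglyMeasurable.aemeasurable.pow_const 2) hγ.lintegral_metricSpeed_sq_ne_top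
  have htotal : ∫ t in Ioo (0 : ℝ) 1, (C * (metricSpeed γ t ^ 2).toReal
      - 2 * (deriv F t * deriv (regularizationTime ε) t)) =
      C * (∫⁻ t in Ioo (0 : ℝ) 1, metricSpeed γ t ^ 2).toReal
        - 2 * ε * (2 * F (1 / 2) - F 0 - F 1) := by
    rw [setIntegral_congr_set Ioo_ae_eq_Ioc, ← intervalIntegral.integral_of_le zero_le_one,
      intervalIntegral.integral_sub hspeed (hint.const_mul 2), intervalIntegral.integral_const_mul,
      intervalIntegral.integral_const_mul, hint_eq, hspeed_eq]
    ring
  have hintegrable := (intervalIntegrable_iff_integrableOn_Ioo_of_le zero_le_one).1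
    (hspeed.sub (hint.const_mul 2))
  rw [← htotal]
  refine ⟨integral_nonneg_of_ae (hae.mono fun t ht => ht.1), ?_⟩
  rw [ofReal_integral_eq_lintegral_ofReal hintegrable (hae.mono fun t ht => ht.1)]
  exact lintegral_mono_ae (hae.mono fun t ht => ht.2)

end Regularization

end IsFlowedCurve

lemma IsFlowedCurve.lintegral_sq_ne_top_and_le {X : Type*} [MetricSpace X] {E : X → EReal}
    {lam ε : ℝ} {γ β : ℝ → X} (hbot : ∀ x, E x ≠ ⊥) (hlsc : LowerSemicontinuous E) (hε : 0 < ε)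
    (hγ : IsAC2 γ) (h : IsFlowedCurve E lam (Icc 0 1) (regularizationTime ε) γ β) :
    ∫⁻ t in Ioo (0 : ℝ) 1, metricSpeed β t ^ 2 ≠ ⊤ ∧
      ∫⁻ t in Ioo (0 : ℝ) 1, metricSlope E (β t) ^ 2 ≠ ⊤ ∧
      (∫⁻ t in Ioo (0 : ℝ) 1, metricSpeed β t ^ 2).toReal
          + ε ^ 2 * (∫⁻ t in Ioo (0 : ℝ) 1, metricSlope E (β t) ^ 2).toReal ≤
        Real.exp (max (-lam) 0 * ε) * (∫⁻ t in Ioo (0 : ℝ) 1, metricSpeed γ t ^ 2).toReal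
          - 2 * ε * (2 * (E (β (1 / 2))).toReal - (E (β 0)).toReal - (E (β 1)).toReal) := by
  obtain ⟨hnonneg, hle⟩ := h.lintegral_metricSpeed_sq_add_le hbot hlsc hε hγ
  have hε_sq : ENNReal.ofReal (ε ^ 2) ≠ 0 := (ENNReal.ofReal_pos.2 (by positivity)).ne'
  have hslope : ∫⁻ t in Ioo (0 : ℝ) 1, ENNReal.ofReal (ε ^ 2) * metricSlope E (β t) ^ 2 ≤
      ∫⁻ t in Ioo (0 : ℝ) 1, ENNReal.ofReal (ε ^ 2) * globalSlope E lam (β t) ^ 2 :=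
    setLIntegral_mono' measurableSet_Ioo fun t ht => by
      gcongr
      exact metricSlope_le_globalSlope hbot (h.lt_top t (Ioo_subset_Icc_self ht))
  rw [lintegral_add_left' ((aemeasurable_metricSpeed zero_le_one
    (h.continuousOn_of_isAC2 hbot hlsc hγ)).pow_const 2)] at hle
  replace hle := (add_le_add_right hslope _).trans hle
  rw [lintegral_const_mul' _ _ ENNReal.ofReal_ne_top] at hle
  have hfin := ENNReal.add_ne_top.1 (ne_top_of_le_ne_top ENNReal.ofReal_ne_top hle)
  refine ⟨hfin.1, fun htop => hfin.2 (by rw [htop, ENNReal.mul_top hε_sq]), ?_⟩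
  have hreal := ENNReal.toReal_mono ENNReal.ofReal_ne_top hle
  rwa [ENNReal.toReal_add hfin.1 hfin.2, ENNReal.toReal_mul, ENNReal.toReal_ofReal (sq_nonneg ε),
    ENNReal.toReal_ofReal hnonneg] at hreal

section RegularizedCurve

variable {X : Type*} [MetricSpace X] {E : X → EReal} {lam ε : ℝ} {γ : ℝ → X}

lemma regularizedCurve_zero : regularizedCurve E lam ε γ 0 = γ 0 := by
  simp [regularizedCurve]

lemma regularizedCurve_one : regularizedCurve E lam ε γ 1 = γ 1 := by
  simp [regularizedCurve]

lemma isFlowedCurve_regularizedCurve (hbot : ∀ x, E x ≠ ⊥) (hlsc : LowerSemicontinuous E)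
    (hε : 0 < ε) (hflow : ∀ t ∈ Icc (0 : ℝ) 1, ∃ η, IsEVIFlowFrom E lam (γ t) η)
    (h0 : E (γ 0) < ⊤) (h1 : E (γ 1) < ⊤) :
    IsFlowedCurve E lam (Icc 0 1) (regularizationTime ε) γ (regularizedCurve E lam ε γ) := by
  have hsemigroup : ∀ t ∈ Icc (0 : ℝ) 1,
      IsIntegralEVIFlow E lam fun r => eviSemigroup E lam r (γ t) := fun t ht =>
    (hflow t ht).elim fun η hη => hη.isIntegralEVIFlow_eviSemigroup hbot hlsc
  refine ⟨fun t ht => ⟨_, hsemigroup t ht, eviSemigroup_zero .., rfl⟩,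
    fun t ht => regularizationTime.nonneg hε ht, fun t ht => ?_⟩
  rcases ht.1.eq_or_lt with rfl | ht_pos
  · rwa [regularizedCurve_zero]
  rcases ht.2.eq_or_lt with rfl | ht_lt
  · rwa [regularizedCurve_one]
  exact (hsemigroup t ht).lt_top _ (regularizationTime.pos hε ⟨ht_pos, ht_lt⟩)

end RegularizedCurve

theorem theorem3p8_general {X : Type*} [MetricSpace X] (E : X → EReal) (lam : ℝ)
    (hbot : ∀ x, E x ≠ ⊥) (hlsc : LowerSemicontinuous E) (ε : ℝ) (hε : 0 < ε) (γ : ℝ → X)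
    (hflow : ∀ t ∈ Icc (0 : ℝ) 1, ∃ η, IsEVIFlowFrom E lam (γ t) η) (hγ : IsAC2 γ)
    (h0 : E (γ 0) < ⊤) (h1 : E (γ 1) < ⊤) :
    IsAC2 (regularizedCurve E lam ε γ) ∧
    ((∀ t ∈ Icc (0 : ℝ) 1, E (regularizedCurve E lam ε γ t) < ⊤) ∧
      AbsolutelyContinuousOnInterval
        (fun t => (E (regularizedCurve E lam ε γ t)).toReal) 0 1) ∧
    MemLp (fun t => metricSlope E (regularizedCurve E lam ε γ t)) 2
      (volume.restrict (Ioo (0 : ℝ) 1)) ∧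
    ((1 / 2 : ℝ) : EReal) *
          ((∫⁻ t in Ioo (0 : ℝ) 1, metricSpeed (regularizedCurve E lam ε γ) t ^ 2 : ℝ≥0∞) :
            EReal)
        + ((ε ^ 2 / 2 : ℝ) : EReal) *
          ((∫⁻ t in Ioo (0 : ℝ) 1, metricSlope E (regularizedCurve E lam ε γ t) ^ 2 : ℝ≥0∞) :
            EReal)
      ≤ ((1 / 2 * Real.exp (max (-lam) 0 * ε) : ℝ) : EReal) *
          ((∫⁻ t in Ioo (0 : ℝ) 1, metricSpeed γ t ^ 2 : ℝ≥0∞) : EReal)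
        - ((2 * ε : ℝ) : EReal) * E (regularizedCurve E lam ε γ (1 / 2))
        + (ε : EReal) * (E (γ 0) + E (γ 1)) := by
  have h := isFlowedCurve_regularizedCurve hbot hlsc hε hflow h0 h1
  have hcont := h.continuousOn_of_isAC2 hbot hlsc hγ
  obtain ⟨hspeed, hslope, hle⟩ := h.lintegral_sq_ne_top_and_le hbot hlsc hε hγ
  refine ⟨.of_locally hcont (fun s t hs hst ht =>
      (h.absolutelyContinuousOnInterval_of_mem_Ioo hbot hlsc hε hγ hs hst ht).1) hspeed,
    ⟨h.lt_top, h.absolutelyContinuousOnInterval_energy hbot hlsc hε hγ⟩,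
    memLp_two_iff_lintegral_sq_ne_top.2
      ⟨aemeasurable_metricSlope_comp hbot hlsc zero_le_one hcont h.lt_top, hslope⟩, ?_⟩
  rw [regularizedCurve_zero, regularizedCurve_one] at hle
  rw [← EReal.coe_ennreal_toReal hspeed, ← EReal.coe_ennreal_toReal hslope,
    ← EReal.coe_ennreal_toReal hγ.lintegral_metricSpeed_sq_ne_top,
    ← EReal.coe_toReal (h.lt_top (1 / 2) (by norm_num)).ne (hbot _),
    ← EReal.coe_toReal h0.ne (hbot _), ← EReal.coe_toReal h1.ne (hbot _)]
  norm_cast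
  linarith

theorem theorem3p8 {X : Type*} [MetricSpace X] [CompleteSpace X]
    [TopologicalSpace.SeparableSpace X] (E : X → EReal) (lam : ℝ) (hE : EVISetting E lam)
    (ε : ℝ) (hε : 0 < ε) (γ : ℝ → X) (hγ : IsAC2 γ) (h0 : E (γ 0) < ⊤) (h1 : E (γ 1) < ⊤) :
    IsAC2 (regularizedCurve E lam ε γ) ∧
    ((∀ t ∈ Set.Icc (0 : ℝ) 1, E (regularizedCurve E lam ε γ t) < ⊤) ∧
      AbsolutelyContinuousOnInterval
        (fun t => (E (regularizedCurve E lam ε γ t)).toReal) 0 1) ∧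
    MemLp (fun t => metricSlope E (regularizedCurve E lam ε γ t)) 2
      (volume.restrict (Set.Ioo (0 : ℝ) 1)) ∧
    ((1 / 2 : ℝ) : EReal) *
          ((∫⁻ t in Set.Ioo (0 : ℝ) 1, metricSpeed (regularizedCurve E lam ε γ) t ^ 2 : ℝ≥0∞) :
            EReal)
        + ((ε ^ 2 / 2 : ℝ) : EReal) *
          ((∫⁻ t in Set.Ioo (0 : ℝ) 1, metricSlope E (regularizedCurve E lam ε γ t) ^ 2 : ℝ≥0∞) : EReal)
      ≤ ((1 / 2 * Real.exp (max (-lam) 0 * ε) : ℝ) : EReal) *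
          ((∫⁻ t in Set.Ioo (0 : ℝ) 1, metricSpeed γ t ^ 2 : ℝ≥0∞) : EReal)
        - ((2 * ε : ℝ) : EReal) * E (regularizedCurve E lam ε γ (1 / 2))
        + (ε : EReal) * (E (γ 0) + E (γ 1)) :=
  theorem3p8_general E lam hE.ne_bot hE.lsc ε hε γ (fun t _ => hE.exists_flow (γ t)) hγ h0 h1
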